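/- Let $L>0$ and let $q:\mathbb R\to\mathbb C$ be $L$-periodic, $q\in C^2([0,L])$, $q\not\equiv0$. *Spectral data.* Let $Q=\begin{pmatrix}0&q\\ \bar q&0\end{pmatrix}$, $\sigma_1=\begin{pmatrix}0&1\\1&0\end{pmatrix}$, $\sigma_3=\mathrm{diag}(1,-1)$, and let $Y(x,z)$ be the solution of $Y_x=(-iz\sigma_3+Q)Y$ with $Y(0,z)=I$. Put $\Delta(z)=\tfrac12\operatorname{tr}Y(L,z)$, $\Sigma=\{z\in\mathbb C:\Delta(z)\in[-1,1]\}$, $U=\begin{pmatrix}1&1\\-i&i\end{pmatrix}$ and $\tilde Y=UYU^{-1}$. The Dirichlet eigenvalues are the $\mu\in\mathbb C$ for which $v_x=(-i\mu\sigma_3+Q)v$ has a non-trivial solution on $[0,L]$ with $v_1+v_2=0$ at $x=0$ and at $x=L$ (equivalently $\tilde y_{12}(L,\mu)=0$); put $\sigma(\mu)=-\operatorname{sgn}\log|\tilde y_{22}(L,\mu)|$. Number the components of $\mathbb R\setminus\Sigma$ (the gaps) from left to right as $(E_{2k-1},E_{2k})$, with $k$ running through an interval of consecutive integers that may be finite or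 infinite on either side. The bands are the intervals $[E_{2n-2},E_{2n-1}]$, where $E_{2n-2}=-\infty$ if $n$ is the first gap and $E_{2n-1}=+\infty$ if $n-1$ is the last gap. *The functions $f^0,f^\pm$.* Let $\epsilon_\mu(z)=(1-z/\mu)e^{z/\mu}$ for $\mu\ne0$ and $\epsilon_0(z)=z$. Let $A_1,B_1$ be the constants of the Hadamard factorization $\tilde y_{12}(L,z)=e^{A_1z+B_1}\prod_\mu\epsilon_\mu(z)$ over all Dirichlet eigenvalues, and let $$f^0=\tfrac12e^{A_1z+B_1}\prod_{\sigma(\mu)=0}\epsilon_\mu(z),\qquad f^\pm=\prod_{\sigma(\mu)=\pm1}\epsilon_\mu(z).$$ *The counting function.* Let $\Gamma$ be the set of Dirichlet eigenvalues $\gamma$ with $\sigma(\gamma)=0$ that lie in some closed gap $[E_{2k-1},E_{2k}]$, and let $\gamma_*$ be an element of $\Gamma$ closest to $0$. Let $m(z)=\#\{\gamma\in\Gamma:\gamma_*\le\gamma\le z\}$ for real $z\ge\gamma_*$ and $m(z)=\#\{\gamma\in\Gamma:z<\gamma<\gamma_*\}$ for real $z<\gamma_*$ ($m\equiv0$ if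 $\Gamma=\emptyset$). *The matrix $B$.* Let $r_0=\sqrt{f^0}$ and $r_4=\sqrt[4]{\Delta^2-1}$ be holomorphic branches on $\mathbb C\setminus\mathbb R$ such that $r_4^2$ is the branch of $\sqrt{\Delta^2-1}$ with $|\Delta-r_4^2|<1$, and such that in the gap $(E_{2n-1},E_{2n})$ the boundary values from above and below satisfy $(r_0/r_4)_+=(-1)^{n+m(z)}(r_0/r_4)_-$. Put $$B=\frac{i\,r_0}{r_4}\,\mathrm{diag}(f^-,f^+)\ \text{ in }\mathbb C^+,\qquad B=\frac{r_0}{r_4}\,\mathrm{diag}(f^+,f^-)\ \text{ in }\mathbb C^-.$$ *The jump matrix.* $$V(x,z)=\begin{cases}(-1)^{n+m(z)}\,\mathrm{diag}(f^- /f^+,\,f^+/f^-),&z\in(E_{2n-2},E_{2n-1}),\\ (-1)^{n+m(z)}\,i\,e^{-2izx\sigma_3}\sigma_1,&z\in(E_{2n-1},E_{2n}).\end{cases}$$ *The domain $\mathcal D$.* Let $\mathcal D$ be $\mathbb C\setminus\mathbb R$ without the closed discs of radius $R=\max_k(E_{2k}-E_{2k-1})$ centred at the mid-points $\tfrac12(E_{2k-1}+E_{2k})$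 of the gaps. **RHP 1** (for fixed $x\in\mathbb R$): find a $2\times2$ matrix function $\Phi(z)$ on $\mathbb C\setminus\mathbb R$ such that 1. $\Phi$ is holomorphic in $\mathbb C\setminus\mathbb R$. 2. $\Phi|_{\mathbb C^\pm}$ extends continuously to $\mathbb R\setminus\{E_k\}$, with continuous boundary values $\Phi^\pm$, and $\Phi(z)=O(|z-E_k|^{-1/4})$ as $z\to E_k$, $z\notin\mathbb R$, for each $k$. 3. $\Phi^+=\Phi^-V$ on $\mathbb R\setminus\{E_k\}$. 4. $\Phi(z)=U(I+O(1/z))B(z)$ as $z\to\infty$ in $\mathbb C\setminus\mathbb R$, uniformly at every fixed positive distance from the gaps: for each $\varepsilon>0$ the estimate holds uniformly on the non-real $z$ whose distance from $\bigcup_k[E_{2k-1},E_{2k}]$ is at least $\varepsilon$. 5. There are $c,M>0$ with $|\phi_{ij}(z)|\le Me^{c|z|^2}$ for all $z\in\mathcal D$ and all $i,j$. **Theorem.** For every fixed $x\in\mathbb R$, RHP 1 has at most one solution. -/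

import Mathlib

open Filter Topology

noncomputable section

namespace ZS

abbrev Mat2 := Matrix (Fin 2) (Fin 2) ℂ

/-! ### The Zakharov-Shabat system `v_x = (-i z σ₃ + Q(x)) v` -/

/-- The coefficient matrix `-i z σ₃ + Q(x)`, with `Q = (0, q; conj q, 0)`. -/
def coeff (q : ℝ → ℂ) (z : ℂ) (x : ℝ) : Mat2 :=
  !![-Complex.I * z, q x; (starRingEnd ℂ) (q x), Complex.I * z]

/-- `Y` is the principal matrix solution for the spectral parameter `z`: it solves the system on
the whole line and `Y(0) = 1`. -/
def IsPrincipalSolution (q : ℝ → ℂ) (z : ℂ) (Y : ℝ → Mat2) : Prop :=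
  Y 0 = 1 ∧ ∀ (x : ℝ) (i j : Fin 2), HasDerivAt (fun s => Y s i j) ((coeff q z x * Y x) i j) x

open Classical in
/-- The principal matrix solution `Y(x, z)`. -/
def principalSolution (q : ℝ → ℂ) (x : ℝ) (z : ℂ) : Mat2 :=
  if h : ∃ Y : ℝ → Mat2, IsPrincipalSolution q z Y then h.choose x else 0

/-- The constant matrix `U`. -/
def U : Mat2 := !![1, 1; -Complex.I, Complex.I]

/-- `U Y(x, z) U⁻¹`. -/
def modifiedSolution (q : ℝ → ℂ) (x : ℝ) (z : ℂ) : Mat2 :=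
  U * principalSolution q x z * U⁻¹

/-- The Floquet discriminant: half the trace of the monodromy matrix `Y(L, z)`. -/
def discriminant (q : ℝ → ℂ) (L : ℝ) (z : ℂ) : ℂ :=
  (principalSolution q L z).trace / 2

/-- The Lax spectrum: the points where the discriminant lies in `[-1, 1]`. -/
def laxSpectrum (q : ℝ → ℂ) (L : ℝ) : Set ℂ :=
  {z | ∃ r : ℝ, r ∈ Set.Icc (-1 : ℝ) 1 ∧ discriminant q L z = (r : ℂ)}

/-- The Dirichlet spectrum with base point `0`: the `μ` for which the system has a non-trivial
solution on `[0, L]` with `v₁ + v₂ = 0` at both end points. -/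
def dirichletSpectrum (q : ℝ → ℂ) (L : ℝ) : Set ℂ :=
  {μ | ∃ v : ℝ → Fin 2 → ℂ,
    (∀ x ∈ Set.Icc (0 : ℝ) L,
      HasDerivWithinAt v ((coeff q μ x).mulVec (v x)) (Set.Icc (0 : ℝ) L) x) ∧
    (∃ x ∈ Set.Icc (0 : ℝ) L, v x ≠ 0) ∧
    v 0 0 + v 0 1 = 0 ∧ v L 0 + v L 1 = 0}

/-- The sign `σ(μ) = -sgn (log |ỹ₂₂(L, μ)|)` attached to a Dirichlet eigenvalue. -/
def dirichletSign (q : ℝ → ℂ) (L : ℝ) (μ : ℂ) : SignType :=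
  -SignType.sign (Real.log ‖modifiedSolution q L μ 1 1‖)

/-- The Dirichlet eigenvalues with a prescribed sign. -/
def dirichletWithSign (q : ℝ → ℂ) (L : ℝ) (s : SignType) : Set ℂ :=
  {μ | μ ∈ dirichletSpectrum q L ∧ dirichletSign q L μ = s}

/-! ### The entire functions `f⁰`, `f⁺`, `f⁻` -/

/-- The elementary factor `(1 - z/μ) e^{z/μ}`, replaced by `z` if `μ = 0`. -/
def elementaryFactor (μ z : ℂ) : ℂ :=
  if μ = 0 then z else (1 - z / μ) * Complex.exp (z / μ)

/-- `f⁺` for `s = 1` and `f⁻` for `s = -1`; the empty product is `1`. -/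
def signProduct (q : ℝ → ℂ) (L : ℝ) (s : SignType) (z : ℂ) : ℂ :=
  ∏' μ : dirichletWithSign q L s, elementaryFactor μ z

/-- `(A₁, B₁)` are the constants of the Hadamard factorization
`ỹ₁₂(L, z) = e^{A₁ z + B₁} ∏_μ (1 - z/μ) e^{z/μ}` over the Dirichlet eigenvalues. -/
def IsHadamardPair (q : ℝ → ℂ) (L : ℝ) (AB : ℂ × ℂ) : Prop :=
  ∀ z : ℂ, ∃ P : ℂ,
    HasProd (fun μ : dirichletSpectrum q L => elementaryFactor μ z) P ∧
    modifiedSolution q L z 0 1 = Complex.exp (AB.1 * z + AB.2) * P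

open Classical in
/-- The exponential factor `e^{A₁ z + B₁}` of the Hadamard factorization of `ỹ₁₂(L, ·)`. -/
def hadamardExp (q : ℝ → ℂ) (L : ℝ) (z : ℂ) : ℂ :=
  if h : ∃ AB : ℂ × ℂ, IsHadamardPair q L AB then
    Complex.exp (h.choose.1 * z + h.choose.2)
  else 0

/-- `f⁰(z) = ½ e^{A₁ z + B₁} ∏_{σ(μ) = 0} (1 - z/μ) e^{z/μ}`. -/
def fZero (q : ℝ → ℂ) (L : ℝ) (z : ℂ) : ℂ :=
  1 / 2 * hadamardExp q L z * signProduct q L 0 z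

/-! ### Spectral gaps -/

/-- An enumeration of the open spectral gaps `(lo k, hi k) = (E_{2k-1}, E_{2k})` from left to right
by an interval `idx` of consecutive integers (bounded or not on either side).  The part of the real
line that is not covered by the gaps is the Lax spectrum. -/
structure GapLabelling (q : ℝ → ℂ) (L : ℝ) where
  idx : Set ℤ
  lo : ℤ → ℝ
  hi : ℤ → ℝ
  nonempty : idx.Nonempty
  ordConnected : idx.OrdConnected
  lo_lt_hi : ∀ k ∈ idx, lo k < hi k
  hi_lt_lo : ∀ k ∈ idx, k + 1 ∈ idx → hi k < lo (k + 1)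
  gaps : {t : ℝ | (t : ℂ) ∉ laxSpectrum q L} = ⋃ k ∈ idx, Set.Ioo (lo k) (hi k)

variable {q : ℝ → ℂ} {L : ℝ}

/-- The non-degenerate band edges `E_k`. -/
def GapLabelling.edges (G : GapLabelling q L) : Set ℝ :=
  {t | ∃ k ∈ G.idx, t = G.lo k ∨ t = G.hi k}

/-- The Dirichlet eigenvalues `γ_k` of the (closed) non-degenerate gaps whose sign is `0`. -/
def GapLabelling.edgeDirichlet (G : GapLabelling q L) : Set ℝ :=
  {t | (∃ k ∈ G.idx, t ∈ Set.Icc (G.lo k) (G.hi k)) ∧ (t : ℂ) ∈ dirichletWithSign q L 0}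

open Classical in
/-- The element `γ_*` of `edgeDirichlet` closest to zero (if there is any). -/
def GapLabelling.gammaStar (G : GapLabelling q L) : ℝ :=
  if h : ∃ g ∈ G.edgeDirichlet, ∀ γ ∈ G.edgeDirichlet, |g| ≤ |γ| then h.choose else 0

/-- The counting function `m`.  It vanishes identically if `edgeDirichlet` is empty. -/
def GapLabelling.count (G : GapLabelling q L) (t : ℝ) : ℕ :=
  if G.gammaStar ≤ t then
    {γ | γ ∈ G.edgeDirichlet ∧ G.gammaStar ≤ γ ∧ γ ≤ t}.ncard
  else
    {γ | γ ∈ G.edgeDirichlet ∧ t < γ ∧ γ < G.gammaStar}.ncard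

/-- The sign `(-1)^{n + m(t)}`. -/
def GapLabelling.jumpSign (G : GapLabelling q L) (n : ℤ) (t : ℝ) : ℂ :=
  (-1 : ℂ) ^ (n + (G.count t : ℤ))

/-- The `n`-th cell: the interval `(E_{2n-2}, E_{2n})` without `E_{2n-1}`, that is the interior of
the `n`-th band `[E_{2n-2}, E_{2n-1}]` together with the `n`-th gap `(E_{2n-1}, E_{2n})`.  For a
first gap `n` the band to its left is unbounded, and for a last gap `n - 1` the cell `n` consists of
the unbounded band to its right. -/
def GapLabelling.cell (G : GapLabelling q L) (n : ℤ) : Set ℝ :=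
  {t | (n ∈ G.idx ∨ n - 1 ∈ G.idx) ∧ (n ∈ G.idx → t < G.hi n) ∧
    (n - 1 ∈ G.idx → G.hi (n - 1) < t) ∧ t ∉ G.edges}

open Classical in
/-- The jump matrix `V(x, t)` for `t` in the `n`-th cell. -/
def GapLabelling.jump (G : GapLabelling q L) (n : ℤ) (x t : ℝ) : Mat2 :=
  if (t : ℂ) ∈ laxSpectrum q L then
    G.jumpSign n t •
      !![signProduct q L (-1) t / signProduct q L 1 t, 0;
         0, signProduct q L 1 t / signProduct q L (-1) t]
  else
    (G.jumpSign n t * Complex.I) •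
      !![0, Complex.exp (-2 * Complex.I * t * x); Complex.exp (2 * Complex.I * t * x), 0]

/-! ### The matrix `B` -/

/-- `r₀ = √f⁰` and `r₄ = ⁴√(Δ² - 1)` are branches, holomorphic off the real line, such that
`r₄² = √(Δ² - 1)` is the branch for which the Floquet multiplier `ρ = Δ - √(Δ² - 1)` has modulus
less than one, and such that the branch cuts on the real line are those that correspond to the
numbering of the gaps: in the `n`-th gap the boundary values of `r₀ / r₄` from above and from below
differ by the factor `(-1)^{n + m}`.  This determines `r₀ / r₄` up to one global sign. -/
structure IsRootBranch (G : GapLabelling q L) (r₀ r₄ : ℂ → ℂ) : Prop where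
  holo₀ : DifferentiableOn ℂ r₀ {z | z.im ≠ 0}
  holo₄ : DifferentiableOn ℂ r₄ {z | z.im ≠ 0}
  sq₀ : ∀ z : ℂ, z.im ≠ 0 → r₀ z ^ 2 = fZero q L z
  pow₄ : ∀ z : ℂ, z.im ≠ 0 → r₄ z ^ 4 = discriminant q L z ^ 2 - 1
  multiplier : ∀ z : ℂ, z.im ≠ 0 → ‖discriminant q L z - r₄ z ^ 2‖ < 1
  cuts : ∀ n ∈ G.idx, ∀ t ∈ Set.Ioo (G.lo n) (G.hi n), ∃ a : ℂ,
    Tendsto (fun z => r₀ z / r₄ z) (𝓝[{z : ℂ | 0 < z.im}] (t : ℂ)) (𝓝 (G.jumpSign n t * a)) ∧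
    Tendsto (fun z => r₀ z / r₄ z) (𝓝[{z : ℂ | z.im < 0}] (t : ℂ)) (𝓝 a)

/-- The matrix `B(z)`, for `z` off the real line. -/
def matB (q : ℝ → ℂ) (L : ℝ) (r₀ r₄ : ℂ → ℂ) (z : ℂ) : Mat2 :=
  if 0 < z.im then
    (Complex.I * r₀ z / r₄ z) • !![signProduct q L (-1) z, 0; 0, signProduct q L 1 z]
  else
    (r₀ z / r₄ z) • !![signProduct q L 1 z, 0; 0, signProduct q L (-1) z]

/-! ### The Riemann-Hilbert problem -/

/-- The common radius of the excised discs: the largest gap length. -/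
def GapLabelling.radius (G : GapLabelling q L) : ℝ :=
  sSup ((fun k => G.hi k - G.lo k) '' G.idx)

/-- The domain `𝒟`: the plane without the real line and without the closed discs of radius `radius`
around the mid-points of the gaps. -/
def GapLabelling.domain (G : GapLabelling q L) : Set ℂ :=
  {z | z.im ≠ 0 ∧ ∀ k ∈ G.idx, G.radius < ‖z - (((G.lo k + G.hi k) / 2 : ℝ) : ℂ)‖}

/-- `Φ` solves the Riemann-Hilbert problem (for fixed `x`). -/
structure IsRHPSolution (G : GapLabelling q L) (r₀ r₄ : ℂ → ℂ) (x : ℝ) (Φ : ℂ → Mat2) : Prop where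
  /-- holomorphy off the real line -/
  holo : ∀ i j, DifferentiableOn ℂ (fun z => Φ z i j) {z | z.im ≠ 0}
  /-- continuous boundary values off the band edges, and the jump relation -/
  boundary : ∃ Φp Φm : ℝ → Mat2,
    ContinuousOn Φp G.edgesᶜ ∧ ContinuousOn Φm G.edgesᶜ ∧
    (∀ t ∉ G.edges, Tendsto Φ (𝓝[{z : ℂ | 0 < z.im}] (t : ℂ)) (𝓝 (Φp t))) ∧
    (∀ t ∉ G.edges, Tendsto Φ (𝓝[{z : ℂ | z.im < 0}] (t : ℂ)) (𝓝 (Φm t))) ∧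
    (∀ n : ℤ, ∀ t ∈ G.cell n, Φp t = Φm t * G.jump n x t)
  /-- at worst quartic root singularities at the band edges -/
  edge : ∀ e ∈ G.edges, ∃ C : ℝ, ∀ᶠ z in 𝓝[{z : ℂ | z.im ≠ 0}] (e : ℂ),
    ∀ i j, ‖Φ z i j‖ ≤ C * ‖z - (e : ℂ)‖ ^ (-(1 / 4) : ℝ)
  /-- `Φ = U (I + O(1/z)) B` as `z → ∞`, uniformly at any fixed positive distance from the gaps -/
  asymptotics : ∀ ε : ℝ, 0 < ε → ∃ C r : ℝ, ∀ z : ℂ, z.im ≠ 0 → r ≤ ‖z‖ →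
    (∀ k ∈ G.idx, ∀ t ∈ Set.Icc (G.lo k) (G.hi k), ε ≤ ‖z - (t : ℂ)‖) →
    ∃ N : Mat2, (∀ i j, ‖N i j‖ ≤ C / ‖z‖) ∧ Φ z = U * (1 + N) * matB q L r₀ r₄ z
  /-- growth on `𝒟` -/
  growth : ∃ c M : ℝ, 0 < c ∧ 0 < M ∧ ∀ z ∈ G.domain, ∀ i j,
    ‖Φ z i j‖ ≤ M * Real.exp (c * ‖z‖ ^ 2)

end ZS

end

/-!
Write `ỹ₁₂ = ỹ₁₂(L, z)` and let `Φ₁`, `Φ₂` be two solutions.  The proof compares them through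
`D = (Φ₁ - Φ₂) adj Φ₂`, which avoids dividing by `det Φ₂`.

*No jump.*  If `Φ⁺ = Φ⁻ V`, then `D⁺ = (det V) D⁻`, and `det V = 1`: in the gaps by inspection, in
the bands because `f⁺` and `f⁻` do not vanish where `ỹ₁₂ ≠ 0`.  The zeros of the entire function
`ỹ₁₂` are isolated, so continuity of the boundary values gives `D⁺ = D⁻` at every point that is
not a band edge (`sub_mul_adjugate_boundary_eq`).  The band edges are zeros of `Δ² - 1`, hence isolated,
and `D = O(|z - E_k|^{-1/2})` there.  By Morera's theorem and Riemann's theorem on removable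
singularities, `D` is the restriction of an entire matrix function
(`exists_differentiable_extension`).

*Decay.*  Where both asymptotic formulas hold,
`D = (det B) U (N₁ - N₂) adj (1 + N₂) adj U` with `N₁, N₂ = O(1/z)`, since `B adj B = (det B) I`.
The Hadamard factorization `2 f⁰ f⁺ f⁻ = ỹ₁₂` gives `|det B|² = |ỹ₁₂|² / (4 |Δ² - 1|)`
(`norm_det_matB_sq`).  From `Y(L, z) = diag (e^{-izL}, e^{izL}) + O(e^{|Im z| L} / z)` one has
`ỹ₁₂ ~ sin zL` and `Δ² - 1 ~ -sin² zL` on the squares centred at `0` with half side length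
`(n + 1/2) π / L`, so that `det B` is bounded and non-zero there.  The vertical sides of large
squares cross the real line inside bands, at a fixed positive distance from the gaps, because
`Δ(t) = cos tL + O(1/t)` for real `t`.  Hence `D = O(1/n)` on the `n`-th square, and `D = 0` by the
maximum principle.

*Conclusion.*  On large squares `det Φ₂ = 2i det (1 + N₂) det B` does not vanish.  Hence `Φ₁ = Φ₂`
near two points of the imaginary axis, one in each half plane, and the identity theorem applies.
If the Hadamard factorization did not exist, `f⁰` and `B` would be zero by convention; both solutions
would vanish far from the gaps, hence everywhere
(`exists_forall_eq_zero_of_not_isHadamardPair`).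

The entries of `Y(L, z)` are entire in `z` by Gronwall's inequality applied to the variational
equation (`differentiable_linear_param`); their asymptotics follow from one step of diagonalization
of the system (`IsZSSolution.norm_snd_sub_le`).
-/

noncomputable section

namespace ZS

/-! ### Linear differential equations with a parameter -/

section LinearODE

variable {E : Type*} [NormedAddCommGroup E] [NormedSpace ℝ E]

/-- The `n`-th term of the Picard series for `y' = A(x) y`, `y(0) = c`. -/
def picardTerm (A : ℝ → E →L[ℝ] E) (c : E) : ℕ → ℝ → E
  | 0 => fun _ => c
  | n + 1 => fun x => ∫ s in (0 : ℝ)..x, A s (picardTerm A c n s)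

theorem picardTerm_continuous [CompleteSpace E] {A : ℝ → E →L[ℝ] E} (hA : Continuous A) (c : E)
    (n : ℕ) : Continuous (picardTerm A c n) := by
  induction n with
  | zero => exact continuous_const
  | succ n ih =>
    exact intervalIntegral.continuous_primitive
      (fun a b => (hA.clm_apply ih).intervalIntegrable a b) 0

theorem hasDerivAt_picardTerm_succ [CompleteSpace E] {A : ℝ → E →L[ℝ] E} (hA : Continuous A)
    (c : E) (n : ℕ) (x : ℝ) :
    HasDerivAt (picardTerm A c (n + 1)) (A x (picardTerm A c n x)) x := by
  have hc : Continuous fun s => A s (picardTerm A c n s) :=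
    hA.clm_apply (picardTerm_continuous hA c n)
  exact intervalIntegral.integral_hasDerivAt_right (hc.intervalIntegrable 0 x)
    hc.aestronglyMeasurable.stronglyMeasurableAtFilter hc.continuousAt

theorem norm_picardTerm_le [CompleteSpace E] {A : ℝ → E →L[ℝ] E} (hA : Continuous A) {K : ℝ}
    (hK : ∀ x, ‖A x‖ ≤ K) (c : E) (n : ℕ) (x : ℝ) :
    ‖picardTerm A c n x‖ ≤ ‖c‖ * ((K * |x|) ^ n / n.factorial) := by
  have hK0 : 0 ≤ K := (norm_nonneg _).trans (hK 0)
  induction n generalizing x with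
  | zero => simp [picardTerm]
  | succ n ih =>
    calc ‖picardTerm A c (n + 1) x‖
        ≤ ∫ s in Set.uIoc 0 x, ‖A s (picardTerm A c n s)‖ :=
          intervalIntegral.norm_integral_le_integral_norm_uIoc
      _ ≤ ∫ s in Set.uIoc 0 x, (‖c‖ * K ^ (n + 1) / n.factorial) * |s - 0| ^ n := by
          refine MeasureTheory.setIntegral_mono_on ?_ ?_ measurableSet_uIoc fun s _ => ?_
          · exact ((hA.clm_apply (picardTerm_continuous hA c n)).norm.intervalIntegrable 0 x).def'
          · refine Continuous.integrableOn_uIoc ?_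
            fun_prop
          · calc ‖A s (picardTerm A c n s)‖ ≤ K * ‖picardTerm A c n s‖ :=
                  (A s).le_of_opNorm_le (hK s) _
              _ ≤ K * (‖c‖ * ((K * |s|) ^ n / n.factorial)) := by gcongr; exact ih s
              _ = _ := by rw [sub_zero, mul_pow]; ring
      _ = _ := by
          rw [MeasureTheory.integral_const_mul, integral_pow_abs_sub_uIoc, Nat.factorial_succ,
            sub_zero]
          push_cast
          field_simp
          ring

/-- A linear equation with a bounded continuous coefficient has global solutions. -/
theorem exists_hasDerivAt_linear [CompleteSpace E] {A : ℝ → E →L[ℝ] E} (hA : Continuous A)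
    {K : ℝ} (hK : ∀ x, ‖A x‖ ≤ K) (c : E) :
    ∃ y : ℝ → E, y 0 = c ∧ ∀ x, HasDerivAt y (A x (y x)) x := by
  have hK0 : 0 ≤ K := (norm_nonneg _).trans (hK 0)
  have hsum : ∀ x, Summable fun n => picardTerm A c n x := fun x =>
    Summable.of_norm_bounded ((Real.summable_pow_div_factorial (K * |x|)).mul_left ‖c‖)
      fun n => norm_picardTerm_le hA hK c n x
  have hzero : ∀ n, picardTerm A c (n + 1) 0 = 0 := fun n => by simp [picardTerm]
  refine ⟨fun x => ∑' n, picardTerm A c n x, ?_, fun x => ?_⟩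
  · simp only [(hsum 0).tsum_eq_zero_add, hzero, tsum_zero, add_zero]
    rfl
  · have hd : HasDerivAt (fun y => ∑' n, picardTerm A c (n + 1) y)
        (∑' n, A x (picardTerm A c n x)) x := by
      refine hasDerivAt_tsum_of_isPreconnected
        (g' := fun n y => A y (picardTerm A c n y))
        (((Real.summable_pow_div_factorial (K * (|x| + 1))).mul_left ‖c‖).mul_left K)
        Metric.isOpen_ball (convex_ball x 1).isPreconnected
        (fun n y _ => hasDerivAt_picardTerm_succ hA c n y) (fun n y hy => ?_)
        (Metric.mem_ball_self one_pos) ((summable_nat_add_iff 1).2 (hsum x))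
        (Metric.mem_ball_self one_pos)
      have hy' : |y| ≤ |x| + 1 := by
        have h1 : |y - x| < 1 := by simpa [Real.dist_eq] using hy
        have h2 := abs_add_le (y - x) x
        rw [sub_add_cancel] at h2
        linarith
      calc ‖A y (picardTerm A c n y)‖ ≤ K * ‖picardTerm A c n y‖ :=
            (A y).le_of_opNorm_le (hK y) _
        _ ≤ K * (‖c‖ * ((K * |y|) ^ n / n.factorial)) := by
            gcongr; exact norm_picardTerm_le hA hK c n y
        _ ≤ K * (‖c‖ * ((K * (|x| + 1)) ^ n / n.factorial)) := by gcongr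
    have he : (fun y => ∑' n, picardTerm A c n y)
        = fun y => c + ∑' n, picardTerm A c (n + 1) y := by
      funext y
      rw [(hsum y).tsum_eq_zero_add]
      rfl
    rw [← (A x).map_tsum (hsum x)] at hd
    rw [show (∑' n, picardTerm A c n x) = c + ∑' n, picardTerm A c (n + 1) x from
      congrFun he x] at hd
    rw [he]
    exact hd.const_add c

/-- Gronwall's inequality with vanishing initial value, with a bound linear in the
inhomogeneity `ε`. -/
theorem norm_le_mul_of_norm_deriv_le {u u' : ℝ → E} {K ε ℓ : ℝ} (hK : 0 < K) (hε : 0 ≤ ε)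
    (hu : ∀ x, HasDerivAt u (u' x) x) (h0 : u 0 = 0)
    (hb : ∀ x ∈ Set.Icc 0 ℓ, ‖u' x‖ ≤ K * ‖u x‖ + ε) {x : ℝ} (hx : x ∈ Set.Icc 0 ℓ) :
    ‖u x‖ ≤ ε * (Real.exp (K * ℓ) / K) := by
  have h := norm_le_gronwallBound_of_norm_deriv_right_le (δ := 0) (K := K) (ε := ε)
    (fun x _ => (hu x).continuousAt.continuousWithinAt)
    (fun x _ => (hu x).hasDerivWithinAt) (by simp [h0])
    (fun x hx => hb x (Set.Ico_subset_Icc_self hx)) x hx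
  simp only [gronwallBound_of_K_ne_0 hK.ne', sub_zero, zero_mul, zero_add] at h
  refine h.trans ?_
  have h1 : Real.exp (K * x) ≤ Real.exp (K * ℓ) := by
    gcongr; exact hx.2
  calc ε / K * (Real.exp (K * x) - 1) ≤ ε / K * Real.exp (K * ℓ) := by
        gcongr; linarith
    _ = _ := by ring

theorem norm_le_mul_exp_of_norm_deriv_le {u u' : ℝ → E} {K ℓ : ℝ} (hK : 0 ≤ K)
    (hu : ∀ x, HasDerivAt u (u' x) x) (hb : ∀ x ∈ Set.Icc 0 ℓ, ‖u' x‖ ≤ K * ‖u x‖) {x : ℝ}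
    (hx : x ∈ Set.Icc 0 ℓ) : ‖u x‖ ≤ ‖u 0‖ * Real.exp (K * ℓ) := by
  have h := norm_le_gronwallBound_of_norm_deriv_right_le (δ := ‖u 0‖) (K := K) (ε := 0)
    (fun x _ => (hu x).continuousAt.continuousWithinAt)
    (fun x _ => (hu x).hasDerivWithinAt) le_rfl
    (fun x hx => by simpa using hb x (Set.Ico_subset_Icc_self hx)) x hx
  rw [gronwallBound_ε0, sub_zero] at h
  refine h.trans ?_
  gcongr
  exact hx.2

end LinearODE

/-- Solutions of `y' = (A(x) + z B) y` with a fixed initial value depend holomorphically on `z`.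
The derivative `Y'` in `z` solves the variational equation, hence `(Y, Y')` solves a linear equation
on `E × E`; two applications of Gronwall's inequality bound the remainder by `|w - z|²`. -/
theorem differentiable_linear_param {E : Type*} [NormedAddCommGroup E] [NormedSpace ℂ E]
    [CompleteSpace E] {A : ℝ → E →L[ℂ] E} (hA : Continuous A) {K : ℝ} (hK : ∀ x, ‖A x‖ ≤ K)
    (B : E →L[ℂ] E) (c : E) {Y : ℂ → ℝ → E} (h0 : ∀ z, Y z 0 = c)
    (hY : ∀ z x, HasDerivAt (Y z) ((A x + z • B) (Y z x)) x) {ℓ : ℝ} (hℓ : 0 ≤ ℓ) :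
    Differentiable ℂ fun z => Y z ℓ := by
  intro z
  have hK0 : 0 ≤ K := (norm_nonneg _).trans (hK 0)
  have hM : ∀ (w : ℂ) (x : ℝ), ‖A x + w • B‖ ≤ K + ‖w‖ * ‖B‖ := fun w x =>
    (norm_add_le _ _).trans (add_le_add (hK x) (norm_smul w B).le)
  -- a bound for the coefficient that is uniform in `|w - z| ≤ 1`
  set κ : ℝ := K + (‖z‖ + 1) * ‖B‖ + 1 with hκ
  have hκ0 : 0 < κ := by positivity
  have hMκ : ∀ w : ℂ, ‖w - z‖ ≤ 1 → ∀ x v, ‖(A x + w • B) v‖ ≤ κ * ‖v‖ := by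
    intro w hw x v
    refine ((A x + w • B).le_of_opNorm_le (hM w x) v).trans ?_
    have : ‖w‖ ≤ ‖z‖ + 1 := by
      have := norm_add_le (w - z) z
      rw [sub_add_cancel] at this
      linarith
    have : ‖w‖ * ‖B‖ ≤ (‖z‖ + 1) * ‖B‖ := by gcongr
    gcongr
    linarith
  -- the variational equation, as the second component of a linear system on `E × E`
  obtain ⟨W, hW0, hW⟩ : ∃ W : ℝ → E, W 0 = 0 ∧
      ∀ x, HasDerivAt W ((A x + z • B) (W x) + B (Y z x)) x := by
    let p₁ := ContinuousLinearMap.fst ℂ E E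
    let p₂ := ContinuousLinearMap.snd ℂ E E
    let i₁ := ContinuousLinearMap.inl ℂ E E
    let i₂ := ContinuousLinearMap.inr ℂ E E
    let F : (E →L[ℂ] E) → (E × E →L[ℂ] E × E) := fun T =>
      i₁.comp (T.comp p₁) + i₂.comp (T.comp p₂ + B.comp p₁)
    let R : (E × E →L[ℂ] E × E) →L[ℝ] (E × E →L[ℝ] E × E) :=
      ContinuousLinearMap.restrictScalarsL ℂ (E × E) (E × E) ℝ ℝ
    have hcont : Continuous fun x => F (A x + z • B) := by fun_prop
    have hbd : ∀ x, ‖F (A x + z • B)‖ ≤ 2 * κ + 2 * ‖B‖ := by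
      intro x
      refine ContinuousLinearMap.opNorm_le_bound _ (by positivity) fun v => ?_
      have hv1 : ‖v.1‖ ≤ ‖v‖ := norm_fst_le v
      have hv2 : ‖v.2‖ ≤ ‖v‖ := norm_snd_le v
      have e1 := hMκ z (by simp) x v.1
      have e2 := hMκ z (by simp) x v.2
      have e3 := B.le_opNorm v.1
      have hF : F (A x + z • B) v = ((A x + z • B) v.1, (A x + z • B) v.2 + B v.1) := by
        ext <;> simp [F, p₁, p₂, i₁, i₂]
      rw [hF, Prod.norm_def]
      have k1 : κ * ‖v.1‖ ≤ κ * ‖v‖ := by gcongr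
      have k2 : κ * ‖v.2‖ ≤ κ * ‖v‖ := by gcongr
      have k3 : ‖B‖ * ‖v.1‖ ≤ ‖B‖ * ‖v‖ := by gcongr
      have k4 : 0 ≤ ‖B‖ * ‖v‖ := by positivity
      have k5 : 0 ≤ κ * ‖v‖ := by positivity
      refine max_le (by dsimp only; linarith) ?_
      have := norm_add_le ((A x + z • B) v.2) (B v.1)
      dsimp only
      linarith
    obtain ⟨y, hy0, hy⟩ := exists_hasDerivAt_linear (A := fun x => R (F (A x + z • B)))
      (R.continuous.comp hcont) (K := ‖R‖ * (2 * κ + 2 * ‖B‖))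
      (fun x => (R.le_opNorm _).trans (by gcongr; exact hbd x)) (c, (0 : E))
    have hy' : ∀ x, HasDerivAt y
        ((A x + z • B) (y x).1, (A x + z • B) (y x).2 + B (y x).1) x := by
      intro x
      refine (hy x).congr_deriv ?_
      ext <;> simp [F, p₁, p₂, i₁, i₂, R]
    have h1 : ∀ x, HasDerivAt (fun x => (y x).1) ((A x + z • B) (y x).1) x := fun x =>
      (ContinuousLinearMap.fst ℝ E E).hasFDerivAt.comp_hasDerivAt x (hy' x)
    have h2 : ∀ x, HasDerivAt (fun x => (y x).2) ((A x + z • B) (y x).2 + B (y x).1) x := fun x =>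
      (ContinuousLinearMap.snd ℝ E E).hasFDerivAt.comp_hasDerivAt x (hy' x)
    -- by uniqueness the first component is `Y z`, on the whole line
    have huniq : ∀ x, (y x).1 = Y z x := by
      have := ODE_solution_unique_univ (v := fun x => (A x + z • B)) (s := fun _ => Set.univ)
        (K := ⟨κ, hκ0.le⟩) (f := fun x => (y x).1) (g := Y z) (t₀ := 0)
        (fun x => (LipschitzWith.of_dist_le_mul fun u v => by
          rw [dist_eq_norm, dist_eq_norm, ← map_sub]
          exact hMκ z (by simp) x _).lipschitzOnWith)
        (fun x => ⟨h1 x, trivial⟩) (fun x => ⟨hY z x, trivial⟩) (by simp [hy0, h0])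
      exact congrFun this
    refine ⟨fun x => (y x).2, by simp [hy0], fun x => ?_⟩
    rw [← huniq x]
    exact h2 x
  set G : ℝ := Real.exp (κ * ℓ) / κ with hG
  have hG0 : 0 ≤ G := by positivity
  set C : ℝ := ‖B‖ * (‖c‖ * Real.exp (κ * ℓ)) with hC
  have hC0 : 0 ≤ C := by positivity
  have hquad : ∀ w : ℂ, ‖w - z‖ ≤ 1 →
      ‖Y w ℓ - Y z ℓ - (w - z) • W ℓ‖ ≤ (‖B‖ * (C * G) * G) * ‖(w - z) ^ 2‖ := by
    intro w hw
    have hYw : ∀ x ∈ Set.Icc 0 ℓ, ‖Y w x‖ ≤ ‖c‖ * Real.exp (κ * ℓ) := fun x hx => by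
      rw [← h0 w]
      exact norm_le_mul_exp_of_norm_deriv_le hκ0.le (hY w) (fun x _ => hMκ w hw x _) hx
    have hF : ∀ x ∈ Set.Icc 0 ℓ, ‖Y w x - Y z x‖ ≤ ‖w - z‖ * C * G := fun x hx => by
      refine norm_le_mul_of_norm_deriv_le (u := fun x => Y w x - Y z x) hκ0 (by positivity)
        (fun x => (hY w x).sub (hY z x)) (by simp [h0]) (fun x hx => ?_) hx
      have : (A x + w • B) (Y w x) - (A x + z • B) (Y z x)
          = (A x + z • B) (Y w x - Y z x) + (w - z) • B (Y w x) := by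
        simp only [add_apply, smul_apply, map_sub]
        module
      rw [this]
      refine (norm_add_le _ _).trans (add_le_add (hMκ z (by simp) x _) ?_)
      rw [norm_smul, hC]
      gcongr
      exact (B.le_opNorm _).trans (by gcongr; exact hYw x hx)
    have := norm_le_mul_of_norm_deriv_le (u := fun x => Y w x - Y z x - (w - z) • W x) hκ0
      (ε := ‖w - z‖ * (‖B‖ * (‖w - z‖ * C * G))) (ℓ := ℓ) (by positivity)
      (fun x => ((hY w x).sub (hY z x)).sub ((hW x).const_smul (w - z))) (by simp [h0, hW0])
      (fun x hx => ?_) ⟨hℓ, le_rfl⟩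
    · refine this.trans (le_of_eq ?_)
      rw [norm_pow]
      ring
    · have : (A x + w • B) (Y w x) - (A x + z • B) (Y z x)
            - (w - z) • ((A x + z • B) (W x) + B (Y z x))
          = (A x + z • B) (Y w x - Y z x - (w - z) • W x) + (w - z) • B (Y w x - Y z x) := by
        simp only [add_apply, smul_apply, map_sub,
          map_smul]
        module
      rw [this]
      refine (norm_add_le _ _).trans (add_le_add (hMκ z (by simp) x _) ?_)
      rw [norm_smul]
      gcongr
      exact (B.le_opNorm _).trans (by gcongr; exact hF x hx)
  refine HasDerivAt.differentiableAt (f' := W ℓ) ?_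
  rw [hasDerivAt_iff_isLittleO]
  refine Asymptotics.IsBigO.trans_isLittleO (g := fun w : ℂ => ‖w - z‖ ^ 2) ?_ ?_
  · refine Asymptotics.IsBigO.of_bound (‖B‖ * (C * G) * G) ?_
    filter_upwards [Metric.closedBall_mem_nhds z one_pos] with w hw
    simpa using hquad w (by simpa [dist_eq_norm] using hw)
  · exact Asymptotics.isLittleO_pow_sub_sub z (m := 2) (by norm_num)

/-! ### The principal solution of the Zakharov-Shabat system -/

/-- A solution `(u, v)` of the Zakharov-Shabat system on the whole line. -/
def IsZSSolution (q : ℝ → ℂ) (z : ℂ) (u v : ℝ → ℂ) : Prop :=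
  ∀ x, HasDerivAt u (-Complex.I * z * u x + q x * v x) x ∧
    HasDerivAt v ((starRingEnd ℂ) (q x) * u x + Complex.I * z * v x) x

theorem isPrincipalSolution_iff {q : ℝ → ℂ} {z : ℂ} {Y : ℝ → Mat2} :
    IsPrincipalSolution q z Y ↔
      Y 0 = 1 ∧ ∀ j, IsZSSolution q z (fun x => Y x 0 j) (fun x => Y x 1 j) := by
  refine and_congr_right fun _ => ?_
  simp only [IsZSSolution, Fin.forall_fin_two, coeff, Matrix.mul_apply, Fin.sum_univ_two,
    Matrix.cons_val_zero, Matrix.cons_val_one, Matrix.of_apply, Matrix.cons_val',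
    Matrix.cons_val_fin_one]
  constructor
  · intro h
    exact ⟨fun x => ⟨(h x).1.1, (h x).2.1⟩, fun x => ⟨(h x).1.2, (h x).2.2⟩⟩
  · intro h x
    exact ⟨⟨(h.1 x).1, (h.2 x).1⟩, ⟨(h.1 x).2, (h.2 x).2⟩⟩

/-- The off-diagonal part of the coefficient, as an operator on `ℂ × ℂ`. -/
def potentialCLM (w : ℂ) : ℂ × ℂ →L[ℂ] ℂ × ℂ :=
  w • (ContinuousLinearMap.inl ℂ ℂ ℂ).comp (ContinuousLinearMap.snd ℂ ℂ ℂ) +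
    (starRingEnd ℂ) w • (ContinuousLinearMap.inr ℂ ℂ ℂ).comp (ContinuousLinearMap.fst ℂ ℂ ℂ)

/-- The operator `-i σ₃` on `ℂ × ℂ`. -/
def spectralCLM : ℂ × ℂ →L[ℂ] ℂ × ℂ :=
  (-Complex.I) • (ContinuousLinearMap.inl ℂ ℂ ℂ).comp (ContinuousLinearMap.fst ℂ ℂ ℂ) +
    Complex.I • (ContinuousLinearMap.inr ℂ ℂ ℂ).comp (ContinuousLinearMap.snd ℂ ℂ ℂ)

theorem coeffCLM_apply (w z : ℂ) (p : ℂ × ℂ) :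
    (potentialCLM w + z • spectralCLM) p =
      (-Complex.I * z * p.1 + w * p.2, (starRingEnd ℂ) w * p.1 + Complex.I * z * p.2) := by
  ext <;> simp [potentialCLM, spectralCLM] <;> ring

theorem continuous_potentialCLM : Continuous potentialCLM := by
  unfold potentialCLM
  exact (continuous_id.smul continuous_const).add
    (Complex.continuous_conj.smul continuous_const)

theorem norm_potentialCLM_le (w : ℂ) : ‖potentialCLM w‖ ≤ ‖w‖ := by
  refine ContinuousLinearMap.opNorm_le_bound _ (norm_nonneg _) fun p => ?_
  have : potentialCLM w p = (w * p.2, (starRingEnd ℂ) w * p.1) := by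
    ext <;> simp [potentialCLM]
  rw [this, Prod.norm_def]
  simp only [norm_mul, RCLike.norm_conj]
  refine max_le ?_ ?_
  · gcongr; exact norm_snd_le p
  · gcongr; exact norm_fst_le p

theorem isZSSolution_iff {q : ℝ → ℂ} {z : ℂ} {y : ℝ → ℂ × ℂ} :
    IsZSSolution q z (fun x => (y x).1) (fun x => (y x).2) ↔
      ∀ x, HasDerivAt y ((potentialCLM (q x) + z • spectralCLM) (y x)) x := by
  refine forall_congr' fun x => ?_
  rw [coeffCLM_apply]
  constructor
  · intro h
    exact h.1.prodMk h.2
  · intro h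
    exact ⟨(ContinuousLinearMap.fst ℝ ℂ ℂ).hasFDerivAt.comp_hasDerivAt x h,
      (ContinuousLinearMap.snd ℝ ℂ ℂ).hasFDerivAt.comp_hasDerivAt x h⟩

section Existence

variable {q : ℝ → ℂ} {K : ℝ}

theorem exists_isZSSolution (hq : Continuous q) (hK : ∀ x, ‖q x‖ ≤ K) (z a b : ℂ) :
    ∃ u v, IsZSSolution q z u v ∧ u 0 = a ∧ v 0 = b := by
  let R : (ℂ × ℂ →L[ℂ] ℂ × ℂ) →L[ℝ] (ℂ × ℂ →L[ℝ] ℂ × ℂ) :=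
    ContinuousLinearMap.restrictScalarsL ℂ (ℂ × ℂ) (ℂ × ℂ) ℝ ℝ
  have hc : Continuous fun x => potentialCLM (q x) + z • spectralCLM :=
    (continuous_potentialCLM.comp hq).add continuous_const
  obtain ⟨y, hy0, hy⟩ := exists_hasDerivAt_linear
    (A := fun x => R (potentialCLM (q x) + z • spectralCLM)) (R.continuous.comp hc)
    (K := ‖R‖ * (K + ‖z • spectralCLM‖))
    (fun x => (R.le_opNorm _).trans (by
      gcongr
      exact (norm_add_le _ _).trans
        (add_le_add ((norm_potentialCLM_le _).trans (hK x)) le_rfl))) (a, b)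
  exact ⟨fun x => (y x).1, fun x => (y x).2, isZSSolution_iff.2 hy, by simp [hy0], by simp [hy0]⟩

theorem isPrincipalSolution_principalSolution (hq : Continuous q) (hK : ∀ x, ‖q x‖ ≤ K) (z : ℂ) :
    IsPrincipalSolution q z fun x => principalSolution q x z := by
  obtain ⟨u₀, v₀, h₀, a₀, b₀⟩ := exists_isZSSolution hq hK z 1 0
  obtain ⟨u₁, v₁, h₁, a₁, b₁⟩ := exists_isZSSolution hq hK z 0 1
  have hex : ∃ Y : ℝ → Mat2, IsPrincipalSolution q z Y := by
    refine ⟨fun x => !![u₀ x, u₁ x; v₀ x, v₁ x], isPrincipalSolution_iff.2 ⟨?_, ?_⟩⟩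
    · ext i j
      fin_cases i <;> fin_cases j <;> simp [a₀, b₀, a₁, b₁]
    · rw [Fin.forall_fin_two]
      exact ⟨by simpa using h₀, by simpa using h₁⟩
  have : (fun x => principalSolution q x z) = hex.choose := by
    funext x
    simp only [principalSolution, dif_pos hex]
  rw [this]
  exact hex.choose_spec

/-- The entries of the monodromy matrix are entire functions of the spectral parameter. -/
theorem differentiable_principalSolution (hq : Continuous q) (hK : ∀ x, ‖q x‖ ≤ K) {L : ℝ}
    (hL : 0 ≤ L) (i j : Fin 2) : Differentiable ℂ fun z => principalSolution q L z i j := by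
  have hs := fun z => isPrincipalSolution_iff.1 (isPrincipalSolution_principalSolution hq hK z)
  have hd := differentiable_linear_param (A := fun x => potentialCLM (q x))
    (continuous_potentialCLM.comp hq) (fun x => (norm_potentialCLM_le _).trans (hK x)) spectralCLM
    ((1 : Mat2) 0 j, (1 : Mat2) 1 j)
    (Y := fun z x => (principalSolution q x z 0 j, principalSolution q x z 1 j))
    (fun z => by rw [(hs z).1]) (fun z => isZSSolution_iff.1 ((hs z).2 j)) hL
  fin_cases i
  · exact fun z => (hd z).fst
  · exact fun z => (hd z).snd

/-- Solutions are determined by their initial values. -/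
theorem IsZSSolution.eq (hK : ∀ x, ‖q x‖ ≤ K) {z : ℂ} {u v u' v' : ℝ → ℂ}
    (h : IsZSSolution q z u v) (h' : IsZSSolution q z u' v') (h0 : u 0 = u' 0) (h1 : v 0 = v' 0)
    {x : ℝ} (hx : 0 ≤ x) : u x = u' x ∧ v x = v' x := by
  have hK0 : 0 ≤ K := (norm_nonneg _).trans (hK 0)
  have e := isZSSolution_iff (y := fun x => (u x, v x)).1 h
  have e' := isZSSolution_iff (y := fun x => (u' x, v' x)).1 h'
  have := norm_le_mul_exp_of_norm_deriv_le (u := fun x => (u x, v x) - (u' x, v' x))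
    (K := K + ‖z • spectralCLM‖) (ℓ := x) (by positivity) (fun x => (e x).sub (e' x))
    (fun y _ => by
      rw [← map_sub]
      exact ContinuousLinearMap.le_of_opNorm_le _ ((norm_add_le _ _).trans
        (add_le_add ((norm_potentialCLM_le _).trans (hK y)) le_rfl)) _)
    ⟨hx, le_rfl⟩
  simp only [h0, h1, sub_self, norm_zero, zero_mul, norm_le_zero_iff, Prod.mk_sub_mk,
    Prod.mk_eq_zero, sub_eq_zero] at this
  exact this

/-- For a real spectral parameter, `(u, v) ↦ (conj v, conj u)` permutes the solutions. -/
theorem principalSolution_one_one_ofReal (hq : Continuous q) (hK : ∀ x, ‖q x‖ ≤ K) {x : ℝ}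
    (hx : 0 ≤ x) (t : ℝ) :
    principalSolution q x t 1 1 = (starRingEnd ℂ) (principalSolution q x t 0 0) := by
  obtain ⟨h0, hs⟩ := isPrincipalSolution_iff.1 (isPrincipalSolution_principalSolution hq hK (t : ℂ))
  have hconj : ∀ {f : ℝ → ℂ} {f' : ℂ} {x : ℝ}, HasDerivAt f f' x →
      HasDerivAt (fun x => (starRingEnd ℂ) (f x)) ((starRingEnd ℂ) f') x := fun h =>
    Complex.conjCLE.toContinuousLinearMap.hasFDerivAt.comp_hasDerivAt _ h
  have hs0 : IsZSSolution q t (fun x => (starRingEnd ℂ) (principalSolution q x t 1 0))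
      (fun x => (starRingEnd ℂ) (principalSolution q x t 0 0)) := by
    intro x
    refine ⟨(hconj (hs 0 x).2).congr_deriv ?_, (hconj (hs 0 x).1).congr_deriv ?_⟩ <;>
    · simp; ring
  exact ((hs 1).eq hK hs0 (by simp [h0]) (by simp [h0]) hx).2

end Existence

/-! ### Asymptotics of the monodromy matrix -/

theorem norm_exp_I_mul_le (w : ℂ) (x : ℝ) (hx : 0 ≤ x) :
    ‖Complex.exp (Complex.I * w * x)‖ ≤ Real.exp (|w.im| * x) := by
  rw [Complex.norm_exp]
  gcongr
  have : (Complex.I * w * x).re = -w.im * x := by simp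
  rw [this]
  gcongr
  exact neg_le_abs _

/-- Exponential growth of solutions, from the estimate of the derivative of `|u|² + |v|²`. -/
theorem IsZSSolution.norm_le {q : ℝ → ℂ} {K : ℝ} (hK : ∀ x, ‖q x‖ ≤ K) {z : ℂ} {u v : ℝ → ℂ}
    (h : IsZSSolution q z u v) (h0 : ‖u 0‖ ^ 2 + ‖v 0‖ ^ 2 = 1) {x : ℝ} (hx : 0 ≤ x) :
    ‖u x‖ ≤ Real.exp ((|z.im| + K) * x) ∧ ‖v x‖ ≤ Real.exp ((|z.im| + K) * x) := by
  have hK0 : 0 ≤ K := (norm_nonneg _).trans (hK 0)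
  have hd := fun x => (h x).1.norm_sq.add (h x).2.norm_sq
  have hb := norm_le_mul_exp_of_norm_deriv_le (K := 2 * (|z.im| + K)) (ℓ := x) (by positivity) hd
    (fun y _ => ?_) ⟨hx, le_rfl⟩
  · simp only [Pi.add_apply, h0, norm_one, one_mul] at hb
    have hsq : ‖u x‖ ^ 2 + ‖v x‖ ^ 2 ≤ Real.exp ((|z.im| + K) * x) ^ 2 := by
      refine (le_abs_self _).trans (hb.trans (le_of_eq ?_))
      rw [← Real.exp_nat_mul]
      congr 1
      push_cast
      ring
    have hE := (Real.exp_pos ((|z.im| + K) * x)).le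
    exact ⟨(pow_le_pow_iff_left₀ (norm_nonneg _) hE two_ne_zero).1 (by nlinarith [sq_nonneg ‖v x‖]),
      (pow_le_pow_iff_left₀ (norm_nonneg _) hE two_ne_zero).1 (by nlinarith [sq_nonneg ‖u x‖])⟩
  · have e : 2 * inner ℝ (u y) (-Complex.I * z * u y + q y * v y) +
        2 * inner ℝ (v y) ((starRingEnd ℂ) (q y) * u y + Complex.I * z * v y)
        = 2 * z.im * (‖u y‖ ^ 2 - ‖v y‖ ^ 2) + 4 * (q y * v y * (starRingEnd ℂ) (u y)).re := by
      simp only [Complex.inner, Complex.sq_norm, Complex.normSq_apply, Complex.mul_re,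
        Complex.mul_im, Complex.add_re, Complex.add_im, Complex.neg_re, Complex.neg_im,
        Complex.conj_re, Complex.conj_im, Complex.I_re, Complex.I_im]
      ring
    have hre : |(q y * v y * (starRingEnd ℂ) (u y)).re| ≤ K * ‖v y‖ * ‖u y‖ := by
      refine (Complex.abs_re_le_norm _).trans ?_
      rw [norm_mul, norm_mul, RCLike.norm_conj]
      gcongr
      exact hK y
    have hsub : |‖u y‖ ^ 2 - ‖v y‖ ^ 2| ≤ ‖u y‖ ^ 2 + ‖v y‖ ^ 2 := by
      rw [abs_le]
      constructor <;> nlinarith [sq_nonneg ‖u y‖, sq_nonneg ‖v y‖]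
    have h2 : 2 * (‖v y‖ * ‖u y‖) ≤ ‖u y‖ ^ 2 + ‖v y‖ ^ 2 := by
      nlinarith [sq_nonneg (‖u y‖ - ‖v y‖)]
    have h3 : |z.im| * |‖u y‖ ^ 2 - ‖v y‖ ^ 2| ≤ |z.im| * (‖u y‖ ^ 2 + ‖v y‖ ^ 2) := by gcongr
    have h4 : K * (2 * (‖v y‖ * ‖u y‖)) ≤ K * (‖u y‖ ^ 2 + ‖v y‖ ^ 2) := by gcongr
    rw [e, Real.norm_eq_abs, Pi.add_apply, Real.norm_eq_abs,
      abs_of_nonneg (by positivity : 0 ≤ ‖u y‖ ^ 2 + ‖v y‖ ^ 2)]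
    refine (abs_add_le _ _).trans ?_
    rw [abs_mul, abs_mul, abs_mul, abs_of_pos (two_pos : (0 : ℝ) < 2),
      abs_of_pos (four_pos : (0 : ℝ) < 4)]
    linarith

/-- Variation of constants for `p' = i λ p + g` with `g = O(e^{|Im λ| x})`. -/
theorem norm_sub_exp_mul_le {p g : ℝ → ℂ} {w : ℂ} {C L : ℝ} (hL : 0 ≤ L) (hC : 0 ≤ C)
    (hcont : ContinuousOn p (Set.Icc 0 L))
    (hp : ∀ x ∈ Set.Ico 0 L, HasDerivWithinAt p (Complex.I * w * p x + g x) (Set.Ici x) x)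
    (hg : ∀ x ∈ Set.Ico 0 L, ‖g x‖ ≤ C * Real.exp (|w.im| * x)) :
    ‖p L - Complex.exp (Complex.I * w * L) * p 0‖ ≤ C * L * Real.exp (|w.im| * L) := by
  have hexp : ∀ x : ℝ, HasDerivAt (fun x : ℝ => Complex.exp (-(Complex.I * w * x)))
      (Complex.exp (-(Complex.I * w * x)) * -(Complex.I * w)) x := fun x => by
    have h1 : HasDerivAt (fun x : ℝ => Complex.I * w * (x : ℂ)) (Complex.I * w) x := by
      simpa using (hasDerivAt_id x).ofReal_comp.const_mul (Complex.I * w)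
    exact h1.neg.cexp
  have hnorm : ∀ x : ℝ, ‖Complex.exp (-(Complex.I * w * x))‖ = Real.exp (w.im * x) := fun x => by
    rw [Complex.norm_exp]
    simp
  have hmv := norm_image_sub_le_of_norm_deriv_right_le_segment
    (f := fun x : ℝ => Complex.exp (-(Complex.I * w * x)) * p x)
    (f' := fun x : ℝ => Complex.exp (-(Complex.I * w * x)) * g x)
    (C := C * Real.exp ((w.im + |w.im|) * L)) (a := 0) (b := L)
    (by
      refine ContinuousOn.mul (Continuous.continuousOn ?_) hcont
      fun_prop)
    (fun x hx => by
      refine ((hexp x).hasDerivWithinAt.mul (hp x hx)).congr_deriv ?_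
      ring)
    (fun x hx => by
      rw [norm_mul, hnorm]
      calc Real.exp (w.im * x) * ‖g x‖ ≤ Real.exp (w.im * x) * (C * Real.exp (|w.im| * x)) := by
            gcongr; exact hg x hx
        _ = C * Real.exp ((w.im + |w.im|) * x) := by rw [add_mul, Real.exp_add]; ring
        _ ≤ C * Real.exp ((w.im + |w.im|) * L) := by
            have : 0 ≤ w.im + |w.im| := by linarith [neg_le_abs w.im]
            gcongr
            exact hx.2.le)
    L ⟨hL, le_rfl⟩
  have e : p L - Complex.exp (Complex.I * w * L) * p 0 = Complex.exp (Complex.I * w * L) *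
      (Complex.exp (-(Complex.I * w * L)) * p L
        - Complex.exp (-(Complex.I * w * (0 : ℝ))) * p 0) := by
    rw [mul_sub, ← mul_assoc, ← mul_assoc, ← Complex.exp_add, add_neg_cancel]
    simp
  have hn : ‖Complex.exp (Complex.I * w * L)‖ = Real.exp (-w.im * L) := by
    rw [Complex.norm_exp]
    simp
  rw [e, norm_mul, hn]
  calc Real.exp (-w.im * L) * _
      ≤ Real.exp (-w.im * L) * (C * Real.exp ((w.im + |w.im|) * L) * (L - 0)) := by gcongr
    _ = C * L * (Real.exp (-w.im * L) * Real.exp ((w.im + |w.im|) * L)) := by ring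
    _ = _ := by
        rw [← Real.exp_add]
        congr 2
        ring

/-- A continuous potential which is bounded by `K`, together with its right derivative on
`[0, L)`. -/
structure IsRegularPotential (q : ℝ → ℂ) (L K : ℝ) : Prop where
  continuous : Continuous q
  bound : ∀ x, ‖q x‖ ≤ K
  deriv : ∃ q₁ : ℝ → ℂ, ∀ x ∈ Set.Ico 0 L,
    HasDerivWithinAt q (q₁ x) (Set.Ici x) x ∧ ‖q₁ x‖ ≤ K

theorem hasDerivWithinAt_conj {f : ℝ → ℂ} {f' : ℂ} {s : Set ℝ} {x : ℝ}
    (h : HasDerivWithinAt f f' s x) :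
    HasDerivWithinAt (fun x => (starRingEnd ℂ) (f x)) ((starRingEnd ℂ) f') s x :=
  Complex.conjCLE.toContinuousLinearMap.hasFDerivAt.comp_hasDerivWithinAt _ h

theorem IsRegularPotential.conj {q : ℝ → ℂ} {L K : ℝ} (h : IsRegularPotential q L K) :
    IsRegularPotential (fun x => (starRingEnd ℂ) (q x)) L K := by
  obtain ⟨q₁, hq₁⟩ := h.deriv
  refine ⟨Complex.continuous_conj.comp h.continuous, fun x => by simpa using h.bound x,
    fun x => (starRingEnd ℂ) (q₁ x), fun x hx => ?_⟩
  exact ⟨hasDerivWithinAt_conj (hq₁ x hx).1, by simpa using (hq₁ x hx).2⟩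

theorem IsZSSolution.swap {q : ℝ → ℂ} {z : ℂ} {u v : ℝ → ℂ} (h : IsZSSolution q z u v) :
    IsZSSolution (fun x => (starRingEnd ℂ) (q x)) (-z) v u := fun x => by
  refine ⟨(h x).2.congr_deriv ?_, (h x).1.congr_deriv ?_⟩ <;>
  · simp; ring

/-- The constant in the asymptotics of the solutions at `x = L`, for a potential which together with
its derivative is bounded by `K`. -/
def asymptoticConst (L K : ℝ) : ℝ :=
  (K + K ^ 2) * Real.exp (K * L) * L / 2 + K * Real.exp (K * L) / 2 + K / 2

/-- The second component of a solution is `e^{izx} v(0)` up to `O(e^{|Im z| x} / z)`.  The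
combination `v + conj q u / (2 i z)` removes the oscillating term `conj q u` from the equation for
`v` up to terms of order `1 / z`. -/
theorem IsZSSolution.norm_snd_sub_le {q : ℝ → ℂ} {L K : ℝ} (hL : 0 ≤ L)
    (hq : IsRegularPotential q L K) {z : ℂ} (hz : z ≠ 0) {u v : ℝ → ℂ}
    (h : IsZSSolution q z u v) (h0 : ‖u 0‖ ^ 2 + ‖v 0‖ ^ 2 = 1) (hu0 : ‖u 0‖ ≤ 1) :
    ‖v L - Complex.exp (Complex.I * z * L) * v 0‖ ≤
      asymptoticConst L K / ‖z‖ * Real.exp (|z.im| * L) := by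
  obtain ⟨q₁, hq₁⟩ := hq.deriv
  have hK0 : 0 ≤ K := (norm_nonneg _).trans (hq.bound 0)
  have hzn : 0 < ‖z‖ := norm_pos_iff.2 hz
  -- chosen so that the terms `conj q u` of order one cancel in the equation for `v + a conj q u`
  set a : ℂ := 1 / (2 * Complex.I * z) with ha
  have haz : 2 * Complex.I * z * a = 1 := by
    rw [ha]; field_simp
  have han : ‖a‖ = 1 / (2 * ‖z‖) := by simp [ha]
  set Q : ℝ → ℂ := fun x => (starRingEnd ℂ) (q x) with hQ
  have hQn : ∀ x, ‖Q x‖ ≤ K := hq.conj.bound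
  have hcu : Continuous u := continuous_iff_continuousAt.2 fun x => (h x).1.continuousAt
  have hcv : Continuous v := continuous_iff_continuousAt.2 fun x => (h x).2.continuousAt
  have hgrow : ∀ x ∈ Set.Icc 0 L, ‖u x‖ ≤ Real.exp (K * L) * Real.exp (|z.im| * x) ∧
      ‖v x‖ ≤ Real.exp (K * L) * Real.exp (|z.im| * x) := by
    intro x hx
    have e : Real.exp ((|z.im| + K) * x) ≤ Real.exp (K * L) * Real.exp (|z.im| * x) := by
      rw [← Real.exp_add]
      have : K * x ≤ K * L := by gcongr; exact hx.2
      gcongr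
      linarith
    exact ⟨(h.norm_le hq.bound h0 hx.1).1.trans e, (h.norm_le hq.bound h0 hx.1).2.trans e⟩
  have hp : ∀ x ∈ Set.Ico 0 L, HasDerivWithinAt (fun x => v x + a * (Q x * u x))
      (Complex.I * z * (v x + a * (Q x * u x)) +
        a * ((starRingEnd ℂ) (q₁ x) * u x + Q x * q x * v x)) (Set.Ici x) x := by
    intro x hx
    have hd := (h x).2.hasDerivWithinAt (s := Set.Ici x) |>.add
      (((hasDerivWithinAt_conj (hq₁ x hx).1).mul
        ((h x).1.hasDerivWithinAt (s := Set.Ici x))).const_mul a)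
    refine hd.congr_deriv ?_
    simp only [hQ]
    linear_combination (-(starRingEnd ℂ) (q x) * u x) * haz
  have hg : ∀ x ∈ Set.Ico 0 L, ‖a * ((starRingEnd ℂ) (q₁ x) * u x + Q x * q x * v x)‖ ≤
      1 / (2 * ‖z‖) * ((K + K ^ 2) * Real.exp (K * L)) * Real.exp (|z.im| * x) := by
    intro x hx
    obtain ⟨h1, h2⟩ := hgrow x (Set.Ico_subset_Icc_self hx)
    rw [norm_mul, han, mul_assoc (1 / (2 * ‖z‖))]
    gcongr
    calc ‖(starRingEnd ℂ) (q₁ x) * u x + Q x * q x * v x‖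
        ≤ ‖(starRingEnd ℂ) (q₁ x)‖ * ‖u x‖ + ‖Q x‖ * ‖q x‖ * ‖v x‖ := by
          refine (norm_add_le _ _).trans ?_
          rw [norm_mul, norm_mul, norm_mul]
      _ ≤ K * (Real.exp (K * L) * Real.exp (|z.im| * x)) +
          K * K * (Real.exp (K * L) * Real.exp (|z.im| * x)) := by
          rw [RCLike.norm_conj]
          gcongr
          · exact (hq₁ x hx).2
          · exact hQn x
          · exact hq.bound x
      _ = _ := by ring
  have hmain : ‖(v L + a * (Q L * u L)) - Complex.exp (Complex.I * z * L) *
      (v 0 + a * (Q 0 * u 0))‖ ≤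
      1 / (2 * ‖z‖) * ((K + K ^ 2) * Real.exp (K * L)) * L * Real.exp (|z.im| * L) := by
    refine norm_sub_exp_mul_le (p := fun x => v x + a * (Q x * u x)) hL (by positivity) ?_ hp hg
    exact (hcv.add (continuous_const.mul (hq.conj.continuous.mul hcu))).continuousOn
  have e : v L - Complex.exp (Complex.I * z * L) * v 0 =
      ((v L + a * (Q L * u L)) - Complex.exp (Complex.I * z * L) * (v 0 + a * (Q 0 * u 0)))
        - a * (Q L * u L) + Complex.exp (Complex.I * z * L) * (a * (Q 0 * u 0)) := by ring
  have t1 : ‖a * (Q L * u L)‖ ≤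
      1 / (2 * ‖z‖) * (K * (Real.exp (K * L) * Real.exp (|z.im| * L))) := by
    rw [norm_mul, norm_mul, han]
    gcongr
    · exact hQn L
    · exact (hgrow L ⟨hL, le_rfl⟩).1
  have t2 : ‖Complex.exp (Complex.I * z * L) * (a * (Q 0 * u 0))‖ ≤
      Real.exp (|z.im| * L) * (1 / (2 * ‖z‖) * (K * 1)) := by
    rw [norm_mul, norm_mul, norm_mul, han]
    gcongr
    · exact norm_exp_I_mul_le z L hL
    · exact hQn 0
  rw [e]
  refine (norm_add_le _ _).trans ((add_le_add ((norm_sub_le _ _).trans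
    (add_le_add hmain t1)) t2).trans (le_of_eq ?_))
  rw [asymptoticConst]
  field_simp

/-- A periodic potential that is `C²` on a period is a regular potential.  At multiples of `L` only
the one-sided derivatives exist. -/
theorem exists_isRegularPotential {q : ℝ → ℂ} {L : ℝ} (hL : 0 < L) (hper : Function.Periodic q L)
    (hq : ContDiffOn ℝ 2 q (Set.Icc 0 L)) : ∃ K, IsRegularPotential q L K := by
  have : Fact (0 < L) := ⟨hL⟩
  have hlift : ∀ x : ℝ, AddCircle.liftIco L 0 q (x : AddCircle L) = q x := by
    intro x
    have h1 : ((toIcoMod hL 0 x : ℝ) : AddCircle L) = x := by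
      rw [← self_sub_toIcoDiv_zsmul hL 0 x, AddCircle.coe_sub, AddCircle.coe_zsmul,
        AddCircle.coe_period, smul_zero, sub_zero]
    rw [← h1, AddCircle.liftIco_coe_apply (toIcoMod_mem_Ico hL 0 x),
      ← self_sub_toIcoDiv_zsmul hL 0 x]
    exact hper.sub_zsmul_eq _
  have hc : Continuous q := by
    have := (AddCircle.liftIco_zero_continuous (p := L) (f := q)
      (by simpa using (hper 0).symm) hq.continuousOn).comp (AddCircle.continuous_mk' L)
    exact this.congr hlift
  have hbdd : ∀ f : ℝ → ℂ, ContinuousOn f (Set.Icc 0 L) → ∃ K, ∀ x ∈ Set.Icc 0 L, ‖f x‖ ≤ K :=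
    fun f hf => isCompact_Icc.exists_bound_of_continuousOn hf
  obtain ⟨K₁, hK₁⟩ := hbdd q hq.continuousOn
  obtain ⟨K₂, hK₂⟩ := hbdd (derivWithin q (Set.Icc 0 L))
    (hq.continuousOn_derivWithin (uniqueDiffOn_Icc hL) (by norm_num))
  refine ⟨max K₁ K₂, hc, fun x => ?_, derivWithin q (Set.Icc 0 L), fun x hx => ⟨?_, ?_⟩⟩
  · have : q x = q (toIcoMod hL 0 x) := by
      rw [← self_sub_toIcoDiv_zsmul hL 0 x]
      exact (hper.sub_zsmul_eq _).symm
    rw [this]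
    have hm := toIcoMod_mem_Ico hL 0 x
    rw [zero_add] at hm
    exact (hK₁ _ (Set.Ico_subset_Icc_self hm)).trans (le_max_left _ _)
  · have hd := (hq.differentiableOn (by norm_num) x (Set.Ico_subset_Icc_self hx)).hasDerivWithinAt
    refine hd.mono_of_mem_nhdsWithin ?_
    exact mem_of_superset (Icc_mem_nhdsGE hx.2) (Set.Icc_subset_Icc_left hx.1)
  · exact (hK₂ _ (Set.Ico_subset_Icc_self hx)).trans (le_max_right _ _)

theorem modifiedSolution_zero_one (q : ℝ → ℂ) (x : ℝ) (z : ℂ) :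
    modifiedSolution q x z 0 1 = Complex.I / 2 *
      (principalSolution q x z 0 0 + principalSolution q x z 1 0
        - principalSolution q x z 0 1 - principalSolution q x z 1 1) := by
  have hU : U⁻¹ = !![1 / 2, Complex.I / 2; 1 / 2, -Complex.I / 2] := by
    refine Matrix.inv_eq_right_inv ?_
    ext i j
    fin_cases i <;> fin_cases j <;> simp [U, Matrix.mul_apply, Fin.sum_univ_two] <;>
      ring_nf <;> simp
  rw [modifiedSolution, hU]
  simp only [Matrix.mul_apply, Fin.sum_univ_two]
  simp [U]
  ring

section Monodromy

variable {q : ℝ → ℂ} {L K : ℝ}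

theorem differentiable_discriminant (hL : 0 ≤ L) (hq : IsRegularPotential q L K) :
    Differentiable ℂ (discriminant q L) := by
  have h := differentiable_principalSolution hq.continuous hq.bound hL
  have : discriminant q L =
      fun z => (principalSolution q L z 0 0 + principalSolution q L z 1 1) / 2 := by
    funext z
    rw [discriminant, Matrix.trace_fin_two]
  rw [this]
  exact ((h 0 0).add (h 1 1)).div_const 2

theorem differentiable_modifiedSolution_zero_one (hL : 0 ≤ L) (hq : IsRegularPotential q L K) :
    Differentiable ℂ fun z => modifiedSolution q L z 0 1 := by
  have h := differentiable_principalSolution hq.continuous hq.bound hL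
  simp only [modifiedSolution_zero_one]
  exact ((((h 0 0).add (h 1 0)).sub (h 0 1)).sub (h 1 1)).const_mul _

/-- The discriminant is real on the real line. -/
theorem discriminant_ofReal_im (hL : 0 ≤ L) (hq : IsRegularPotential q L K) (t : ℝ) :
    (discriminant q L t).im = 0 := by
  rw [discriminant, Matrix.trace_fin_two,
    principalSolution_one_one_ofReal hq.continuous hq.bound hL t]
  rw [Complex.add_conj, ← Complex.ofReal_ofNat, ← Complex.ofReal_div, Complex.ofReal_im]

theorem norm_monodromy_sub_le (hL : 0 ≤ L) (hq : IsRegularPotential q L K) {z : ℂ} (hz : z ≠ 0) :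
    ‖principalSolution q L z 0 0 - Complex.exp (-(Complex.I * z * L))‖ ≤
        asymptoticConst L K / ‖z‖ * Real.exp (|z.im| * L) ∧
      ‖principalSolution q L z 1 0‖ ≤ asymptoticConst L K / ‖z‖ * Real.exp (|z.im| * L) ∧
      ‖principalSolution q L z 0 1‖ ≤ asymptoticConst L K / ‖z‖ * Real.exp (|z.im| * L) ∧
      ‖principalSolution q L z 1 1 - Complex.exp (Complex.I * z * L)‖ ≤
        asymptoticConst L K / ‖z‖ * Real.exp (|z.im| * L) := by
  obtain ⟨h0, hs⟩ := isPrincipalSolution_iff.1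
    (isPrincipalSolution_principalSolution hq.continuous hq.bound z)
  have hz' : -z ≠ 0 := neg_ne_zero.2 hz
  have a := (hs 0).swap.norm_snd_sub_le hL hq.conj hz' (by simp [h0]) (by simp [h0])
  have b := (hs 0).norm_snd_sub_le hL hq hz (by simp [h0]) (by simp [h0])
  have c := (hs 1).swap.norm_snd_sub_le hL hq.conj hz' (by simp [h0]) (by simp [h0])
  have d := (hs 1).norm_snd_sub_le hL hq hz (by simp [h0]) (by simp [h0])
  simp only [h0, Matrix.one_apply_eq, mul_one, norm_neg, Complex.neg_im, abs_neg, mul_neg,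
    neg_mul] at a d
  simp only [h0, Matrix.one_apply_ne (show (1 : Fin 2) ≠ 0 by decide),
    Matrix.one_apply_ne (show (0 : Fin 2) ≠ 1 by decide), mul_zero, sub_zero, norm_neg,
    Complex.neg_im, abs_neg] at b c
  exact ⟨a, b, c, d⟩

theorem norm_discriminant_sub_cos_le (hL : 0 ≤ L) (hq : IsRegularPotential q L K) {z : ℂ}
    (hz : z ≠ 0) : ‖discriminant q L z - Complex.cos (z * L)‖ ≤
      2 * asymptoticConst L K / ‖z‖ * Real.exp (|z.im| * L) := by
  obtain ⟨a, b, c, d⟩ := norm_monodromy_sub_le hL hq hz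
  have e : discriminant q L z - Complex.cos (z * L) =
      ((principalSolution q L z 0 0 - Complex.exp (-(Complex.I * z * L))) +
        (principalSolution q L z 1 1 - Complex.exp (Complex.I * z * L))) / 2 := by
    rw [discriminant, Matrix.trace_fin_two, Complex.cos]
    ring_nf
  have hn := norm_add_le (principalSolution q L z 0 0 - Complex.exp (-(Complex.I * z * L)))
    (principalSolution q L z 1 1 - Complex.exp (Complex.I * z * L))
  have h0 := norm_nonneg (principalSolution q L z 1 0)
  rw [e, norm_div, Complex.norm_two, mul_div_assoc, mul_assoc 2]
  linarith

theorem norm_modifiedSolution_sub_sin_le (hL : 0 ≤ L) (hq : IsRegularPotential q L K) {z : ℂ}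
    (hz : z ≠ 0) : ‖modifiedSolution q L z 0 1 - Complex.sin (z * L)‖ ≤
      2 * asymptoticConst L K / ‖z‖ * Real.exp (|z.im| * L) := by
  obtain ⟨a, b, c, d⟩ := norm_monodromy_sub_le hL hq hz
  have e : modifiedSolution q L z 0 1 - Complex.sin (z * L) = Complex.I / 2 *
      ((principalSolution q L z 0 0 - Complex.exp (-(Complex.I * z * L))) +
        principalSolution q L z 1 0 - principalSolution q L z 0 1
        - (principalSolution q L z 1 1 - Complex.exp (Complex.I * z * L))) := by
    rw [modifiedSolution_zero_one, Complex.sin]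
    ring_nf
  rw [e, norm_mul, norm_div, Complex.norm_two, Complex.norm_I, mul_div_assoc, mul_assoc 2]
  have h1 := norm_sub_le ((principalSolution q L z 0 0 - Complex.exp (-(Complex.I * z * L))) +
        principalSolution q L z 1 0 - principalSolution q L z 0 1)
        (principalSolution q L z 1 1 - Complex.exp (Complex.I * z * L))
  have h2 := norm_sub_le ((principalSolution q L z 0 0 - Complex.exp (-(Complex.I * z * L))) +
        principalSolution q L z 1 0) (principalSolution q L z 0 1)
  have h3 := norm_add_le (principalSolution q L z 0 0 - Complex.exp (-(Complex.I * z * L)))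
        (principalSolution q L z 1 0)
  linarith

theorem norm_cos_le_exp (z : ℂ) (hL : 0 ≤ L) : ‖Complex.cos (z * L)‖ ≤ Real.exp (|z.im| * L) := by
  have h1 := norm_exp_I_mul_le z L hL
  have h2 := norm_exp_I_mul_le (-z) L hL
  rw [Complex.neg_im, abs_neg] at h2
  have e : Complex.cos (z * L) =
      (Complex.exp (Complex.I * z * L) + Complex.exp (Complex.I * -z * L)) / 2 := by
    rw [Complex.cos]
    ring_nf
  rw [e, norm_div, Complex.norm_two]
  linarith [norm_add_le (Complex.exp (Complex.I * z * L)) (Complex.exp (Complex.I * -z * L))]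

theorem norm_sin_le_exp (z : ℂ) (hL : 0 ≤ L) : ‖Complex.sin (z * L)‖ ≤ Real.exp (|z.im| * L) := by
  have h1 := norm_exp_I_mul_le z L hL
  have h2 := norm_exp_I_mul_le (-z) L hL
  rw [Complex.neg_im, abs_neg] at h2
  have e : Complex.sin (z * L) =
      (Complex.exp (Complex.I * -z * L) - Complex.exp (Complex.I * z * L)) * Complex.I / 2 := by
    rw [Complex.sin]
    ring_nf
  rw [e, norm_div, Complex.norm_two, norm_mul, Complex.norm_I]
  linarith [norm_sub_le (Complex.exp (Complex.I * -z * L)) (Complex.exp (Complex.I * z * L))]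

/-- Where `|sin zL|` is comparable to `e^{|Im z| L}` and `z` is large, the quotient of `ỹ₁₂(L, z)`
by `√(Δ² - 1)` is bounded, and neither of the two vanishes. -/
theorem exists_modifiedSolution_sq_le (hL : 0 ≤ L) (hq : IsRegularPotential q L K) :
    ∃ ρ : ℝ, 0 < ρ ∧ ∀ z : ℂ, ρ ≤ ‖z‖ → Real.exp (|z.im| * L) ≤ 4 * ‖Complex.sin (z * L)‖ →
      modifiedSolution q L z 0 1 ≠ 0 ∧ discriminant q L z ^ 2 - 1 ≠ 0 ∧
      ‖modifiedSolution q L z 0 1‖ ^ 2 ≤ 128 * ‖discriminant q L z ^ 2 - 1‖ := by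
  set C := max (2 * asymptoticConst L K) 1 with hC
  have hC1 : 1 ≤ C := le_max_right _ _
  -- for `‖z‖ ≥ 100 C` the errors are at most `T / 100`, small against `|sin zL| ≥ T / 4`
  refine ⟨100 * C, by positivity, fun z hz hsin => ?_⟩
  have hzn : 0 < ‖z‖ := lt_of_lt_of_le (by positivity) hz
  have hz0 : z ≠ 0 := norm_pos_iff.1 hzn
  set T := Real.exp (|z.im| * L) with hT
  have hT0 : 0 < T := Real.exp_pos _
  have hδ : 2 * asymptoticConst L K / ‖z‖ * T ≤ T / 100 := by
    have : 2 * asymptoticConst L K / ‖z‖ ≤ 1 / 100 := by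
      rw [div_le_div_iff₀ hzn (by norm_num)]
      linarith [le_max_left (2 * asymptoticConst L K) 1]
    nlinarith
  have hD := (norm_discriminant_sub_cos_le hL hq hz0).trans hδ
  have hM := (norm_modifiedSolution_sub_sin_le hL hq hz0).trans hδ
  have hcos := norm_cos_le_exp z hL
  have hsin' := norm_sin_le_exp z hL
  set M := modifiedSolution q L z 0 1
  set D := discriminant q L z
  set c := Complex.cos (z * L)
  set s := Complex.sin (z * L)
  have hMle : ‖M‖ ≤ 2 * T := by
    have := norm_add_le (M - s) s
    rw [sub_add_cancel] at this
    linarith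
  have hMpos : 0 < ‖M‖ := by
    have := norm_sub_norm_le s (s - M)
    rw [sub_sub_cancel, norm_sub_rev s M] at this
    linarith
  have e : D ^ 2 - 1 = (D - c) * ((D - c) + 2 * c) - s ^ 2 := by
    have := Complex.sin_sq_add_cos_sq (z * L)
    linear_combination this
  have hlow : T ^ 2 / 32 ≤ ‖D ^ 2 - 1‖ := by
    have h1 : ‖(D - c) * ((D - c) + 2 * c)‖ ≤ T / 100 * (T / 100 + 2 * T) := by
      rw [norm_mul]
      gcongr
      refine (norm_add_le _ _).trans (add_le_add hD ?_)
      rw [norm_mul, Complex.norm_two]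
      gcongr
    have h2 : (T / 4) ^ 2 ≤ ‖s ^ 2‖ := by
      rw [norm_pow]
      gcongr
      linarith
    have h3 := norm_sub_norm_le (s ^ 2) ((D - c) * ((D - c) + 2 * c))
    rw [e, norm_sub_rev]
    nlinarith
  refine ⟨norm_pos_iff.1 hMpos, norm_pos_iff.1 (lt_of_lt_of_le (by positivity) hlow), ?_⟩
  calc ‖M‖ ^ 2 ≤ (2 * T) ^ 2 := by gcongr
    _ = 128 * (T ^ 2 / 32) := by ring
    _ ≤ _ := by gcongr

/-- For large real `t` with `|cos tL| ≤ 1/4`, the point `t` is interior to a band. -/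
theorem exists_norm_discriminant_lt_one (hL : 0 ≤ L) (hq : IsRegularPotential q L K) :
    ∃ ρ : ℝ, 0 < ρ ∧ ∀ t : ℝ, ρ ≤ |t| → |Real.cos (t * L)| ≤ 1 / 4 → ‖discriminant q L t‖ < 1 := by
  set C := max (2 * asymptoticConst L K) 1 with hC
  have hC1 : 1 ≤ C := le_max_right _ _
  refine ⟨2 * C, by positivity, fun t ht hcos => ?_⟩
  have htn : 0 < |t| := lt_of_lt_of_le (by positivity) ht
  have hD := norm_discriminant_sub_cos_le hL hq (z := (t : ℂ)) (by simpa using htn)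
  rw [Complex.ofReal_im, abs_zero, zero_mul, Real.exp_zero, mul_one, Complex.norm_real,
    Real.norm_eq_abs, ← Complex.ofReal_mul, ← Complex.ofReal_cos] at hD
  have h2 : 2 * asymptoticConst L K / |t| ≤ 1 / 2 := by
    rw [div_le_div_iff₀ htn (by norm_num)]
    linarith [le_max_left (2 * asymptoticConst L K) 1]
  have h3 := norm_add_le (discriminant q L t - (Real.cos (t * L) : ℝ)) ((Real.cos (t * L) : ℝ) : ℂ)
  rw [sub_add_cancel, Complex.norm_real (Real.cos (t * L)), Real.norm_eq_abs] at h3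
  linarith

end Monodromy

/-! ### Functions that are holomorphic off the real line -/

section RealLine

theorem isOpen_im_ne_zero : IsOpen {z : ℂ | z.im ≠ 0} :=
  isOpen_ne_fun Complex.continuous_im continuous_const

/-- A continuous function that is holomorphic off the real line is holomorphic: rectangles are
cut along the real line, so that Morera's theorem applies. -/
theorem differentiableOn_of_differentiableOn_im_ne_zero {f : ℂ → ℂ} {U : Set ℂ} (hU : IsOpen U)
    (hc : ContinuousOn f U) (hd : DifferentiableOn ℂ f (U ∩ {z | z.im ≠ 0})) :
    DifferentiableOn ℂ f U := by
  refine (Complex.isConservativeOn_and_continuousOn_iff_isDifferentiableOn hU).1 ⟨?_, hc⟩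
  intro z w hzw
  rw [← add_eq_zero_iff_eq_neg, Complex.wedgeIntegral_add_wedgeIntegral_eq]
  have hRect : Set.uIcc z.re w.re ×ℂ Set.uIcc z.im w.im ⊆ U := hzw
  -- rectangles whose interior does not meet the real line
  have key : ∀ c d : ℝ, Set.uIcc c d ⊆ Set.uIcc z.im w.im →
      (∀ y ∈ Set.Ioo (min c d) (max c d), y ≠ 0) →
      (∫ x : ℝ in z.re..w.re, f (x + c * Complex.I)) -
        (∫ x : ℝ in z.re..w.re, f (x + d * Complex.I)) +
        Complex.I • (∫ y : ℝ in c..d, f (w.re + y * Complex.I)) -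
        Complex.I • (∫ y : ℝ in c..d, f (z.re + y * Complex.I)) = 0 := by
    intro c d hcd h0
    have hsub : Set.uIcc z.re w.re ×ℂ Set.uIcc c d ⊆ U :=
      (Complex.reProdIm_subset_iff.2 (Set.prod_mono subset_rfl hcd)).trans hRect
    have := Complex.integral_boundary_rect_eq_zero_of_continuousOn_of_differentiableOn f
      (⟨z.re, c⟩ : ℂ) ⟨w.re, d⟩ (hc.mono hsub) (hd.mono fun p hp => ⟨?_, h0 p.im hp.2⟩)
    · simpa using this
    · exact hsub ⟨Set.Ioo_subset_Icc_self hp.1, Set.Ioo_subset_Icc_self hp.2⟩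
  by_cases h : (0 : ℝ) ∈ Set.uIcc z.im w.im
  · have h1 := key z.im 0 (Set.uIcc_subset_uIcc_left h) fun y hy hy0 => by
      subst hy0
      simp only [Set.mem_Ioo, min_lt_iff, lt_max_iff, lt_self_iff_false, or_false] at hy
      linarith [hy.1, hy.2]
    have h2 := key 0 w.im (Set.uIcc_subset_uIcc_right h) fun y hy hy0 => by
      subst hy0
      simp only [Set.mem_Ioo, min_lt_iff, lt_max_iff, lt_self_iff_false, false_or] at hy
      linarith [hy.1, hy.2]
    have hint : ∀ r ∈ Set.uIcc z.re w.re, ∀ c d : ℝ, Set.uIcc c d ⊆ Set.uIcc z.im w.im →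
        IntervalIntegrable (fun y : ℝ => f (r + y * Complex.I)) MeasureTheory.volume c d := by
      intro r hr c d hcd
      refine ContinuousOn.intervalIntegrable (hc.comp (by fun_prop) fun y hy => hRect ?_)
      rw [Complex.mem_reProdIm]
      simpa using ⟨hr, hcd hy⟩
    rw [← intervalIntegral.integral_add_adjacent_intervals
        (hint w.re Set.right_mem_uIcc z.im 0 (Set.uIcc_subset_uIcc_left h))
        (hint w.re Set.right_mem_uIcc 0 w.im (Set.uIcc_subset_uIcc_right h)),
      ← intervalIntegral.integral_add_adjacent_intervals
        (hint z.re Set.left_mem_uIcc z.im 0 (Set.uIcc_subset_uIcc_left h))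
        (hint z.re Set.left_mem_uIcc 0 w.im (Set.uIcc_subset_uIcc_right h)),
      smul_add, smul_add]
    linear_combination h1 + h2
  · refine key z.im w.im subset_rfl fun y hy hy0 => h ?_
    rw [← hy0]
    exact Set.Ioo_subset_Icc_self hy

theorem neBot_nhdsWithin_im_pos (t : ℝ) : (𝓝[{z : ℂ | 0 < z.im}] (t : ℂ)).NeBot := by
  rw [← mem_closure_iff_nhdsWithin_neBot, Complex.closure_setOfPred_lt_im]
  simp

theorem nhds_eq_sup_im (t : ℂ) : 𝓝 t = 𝓝[{z : ℂ | 0 < z.im}] t ⊔ 𝓝[{z : ℂ | z.im < 0}] t ⊔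
    𝓝[{z : ℂ | z.im = 0}] t := by
  rw [← nhdsWithin_union, ← nhdsWithin_union, ← nhdsWithin_univ]
  congr 1
  ext z
  rcases lt_trichotomy z.im 0 with h | h | h <;> simp [h]

/-- A function which is holomorphic off the real line, has equal continuous boundary values from
both sides off a discrete set `S`, and has singularities weaker than simple poles in the points of
`S`, is the restriction of an entire function. -/
theorem exists_differentiable_extension {f : ℂ → ℂ} {S : Set ℝ} {φ : ℝ → ℂ}
    (hS : ∀ t : ℝ, ∀ᶠ s in 𝓝[≠] t, s ∉ S)
    (hf : DifferentiableOn ℂ f {z | z.im ≠ 0}) (hφ : ContinuousOn φ Sᶜ)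
    (hup : ∀ t ∉ S, Tendsto f (𝓝[{z : ℂ | 0 < z.im}] (t : ℂ)) (𝓝 (φ t)))
    (hdown : ∀ t ∉ S, Tendsto f (𝓝[{z : ℂ | z.im < 0}] (t : ℂ)) (𝓝 (φ t)))
    (hedge : ∀ e ∈ S, ∃ C : ℝ, ∀ᶠ z in 𝓝[{z : ℂ | z.im ≠ 0}] (e : ℂ),
      ‖f z‖ ≤ C * ‖z - (e : ℂ)‖ ^ (-(1 / 2) : ℝ)) :
    ∃ F : ℂ → ℂ, Differentiable ℂ F ∧ ∀ z, z.im ≠ 0 → F z = f z := by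
  classical
  set g : ℂ → ℂ := fun z => if z.im = 0 then φ z.re else f z with hg
  have hgf : ∀ z : ℂ, z.im ≠ 0 → g z = f z := fun z hz => if_neg hz
  have hgφ : ∀ t : ℝ, g t = φ t := fun t => by simp [hg]
  set Ω : Set ℂ := {z | z.im = 0 → z.re ∉ S} with hΩ
  have hSc : IsOpen Sᶜ := by
    rw [isOpen_iff_mem_nhds]
    intro t ht
    have := hS t
    rw [eventually_nhdsWithin_iff] at this
    filter_upwards [this] with s hs
    by_cases hst : s = t
    · rwa [hst]
    · exact hs hst
  have hsplit : ∀ z : ℂ, z.im = 0 → z = (z.re : ℂ) := fun z hz => by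
    apply Complex.ext <;> simp [hz]
  have hpunct : ∀ c : ℂ, ∀ᶠ z in 𝓝[≠] c, z ∈ Ω := by
    intro c
    rw [eventually_nhdsWithin_iff]
    by_cases hc : c.im = 0
    · have h1 := hS c.re
      rw [eventually_nhdsWithin_iff] at h1
      filter_upwards [Complex.continuous_re.continuousAt.eventually h1] with z hz hzc hz0
      refine hz fun h => hzc ?_
      rw [Set.mem_singleton_iff, hsplit z hz0, hsplit c hc, h]
    · filter_upwards [isOpen_im_ne_zero.mem_nhds hc] with z hz _ h0
      exact absurd h0 hz
  have hΩo : IsOpen Ω := by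
    rw [isOpen_iff_mem_nhds]
    intro c hc
    have := hpunct c
    rw [eventually_nhdsWithin_iff] at this
    filter_upwards [this] with z hz
    by_cases hzc : z = c
    · rwa [hzc]
    · exact hz hzc
  have hgc : ContinuousOn g Ω := by
    intro c hc
    refine ContinuousAt.continuousWithinAt ?_
    by_cases h0 : c.im = 0
    · have hcS := hc h0
      rw [hsplit c h0, ContinuousAt, nhds_eq_sup_im, hgφ]
      refine (Tendsto.sup (Tendsto.congr' ?_ (hup _ hcS)) (Tendsto.congr' ?_ (hdown _ hcS))).sup ?_
      · filter_upwards [self_mem_nhdsWithin] with z hz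
        exact (hgf z (ne_of_gt hz)).symm
      · filter_upwards [self_mem_nhdsWithin] with z hz
        exact (hgf z (ne_of_lt hz)).symm
      · have h1 : Tendsto (fun z : ℂ => φ z.re) (𝓝 (c.re : ℂ)) (𝓝 (φ c.re)) := by
          have h2 : ContinuousAt φ c.re := hφ.continuousAt (hSc.mem_nhds hcS)
          exact Tendsto.comp (g := φ) h2 (by
            simpa using Complex.continuous_re.tendsto (c.re : ℂ))
        refine Tendsto.congr' ?_ (h1.mono_left nhdsWithin_le_nhds)
        filter_upwards [self_mem_nhdsWithin] with z hz
        exact (if_pos hz).symm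
    · refine ((hf.differentiableAt (isOpen_im_ne_zero.mem_nhds h0)).continuousAt).congr ?_
      filter_upwards [isOpen_im_ne_zero.mem_nhds h0] with z hz
      exact (hgf z hz).symm
  have hgd : DifferentiableOn ℂ g Ω := by
    refine differentiableOn_of_differentiableOn_im_ne_zero hΩo hgc ?_
    exact (hf.congr fun z hz => hgf z hz).mono Set.inter_subset_right
  -- the singularities in the points of `S` are weaker than simple poles, also along the real line
  have hlittle : ∀ c : ℂ, (fun z => g z - g c) =o[𝓝[≠] c] fun z => (z - c)⁻¹ := by
    intro c
    have hconst : (fun _ : ℂ => g c) =o[𝓝[≠] c] fun z => (z - c)⁻¹ := by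
      refine Asymptotics.isLittleO_const_left.2 (Or.inr ?_)
      have h1 : Tendsto (fun z => z - c) (𝓝[≠] c) (𝓝[≠] 0) := by
        refine tendsto_nhdsWithin_iff.2 ⟨?_, ?_⟩
        · have : Tendsto (fun z => z - c) (𝓝 c) (𝓝 (c - c)) := tendsto_id.sub_const c
          rw [sub_self] at this
          exact this.mono_left nhdsWithin_le_nhds
        · filter_upwards [self_mem_nhdsWithin] with z hz
          exact sub_ne_zero.2 hz
      have h2 := tendsto_norm_inv_nhdsNE_zero_atTop.comp h1
      exact h2
    refine Asymptotics.IsLittleO.sub ?_ hconst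
    have hbound : ∃ C : ℝ, ∀ᶠ z in 𝓝[≠] c, ‖g z‖ ≤ C * ‖z - c‖ ^ (-(1 / 2) : ℝ) := by
      by_cases hcΩ : c ∈ Ω
      · have hct : ContinuousAt g c := hgc.continuousAt (hΩo.mem_nhds hcΩ)
        refine ⟨‖g c‖ + 1, ?_⟩
        have h1 : ∀ᶠ z in 𝓝 c, ‖g z‖ < ‖g c‖ + 1 :=
          hct.norm.eventually_lt continuousAt_const (lt_add_one _)
        refine eventually_nhdsWithin_iff.2 ?_
        filter_upwards [h1, Metric.ball_mem_nhds c one_pos] with z hz hz1 hzc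
        have hpos : 0 < ‖z - c‖ := norm_pos_iff.2 (sub_ne_zero.2 hzc)
        have h2 : 1 ≤ ‖z - c‖ ^ (-(1 / 2) : ℝ) :=
          Real.one_le_rpow_of_pos_of_le_one_of_nonpos hpos
            (by rw [← dist_eq_norm]; exact (Metric.mem_ball.1 hz1).le) (by norm_num)
        nlinarith [norm_nonneg (g c)]
      · have hc0 : c.im = 0 := by
          by_contra h
          exact hcΩ fun h' => absurd h' h
        have hcS : c.re ∈ S := by
          by_contra h
          exact hcΩ fun _ => h
        obtain ⟨C, hC⟩ := hedge c.re hcS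
        rw [← hsplit c hc0] at hC
        refine ⟨C, ?_⟩
        have h1 := (eventually_eventually_nhds.2 (eventually_nhdsWithin_iff.1 hC))
        filter_upwards [h1.filter_mono nhdsWithin_le_nhds, hpunct c, self_mem_nhdsWithin]
          with z hz hzΩ hzc
        by_cases hz0 : z.im = 0
        · have hlim : Tendsto g (𝓝[{z : ℂ | 0 < z.im}] z) (𝓝 (g z)) :=
            (hgc.continuousAt (hΩo.mem_nhds hzΩ)).tendsto.mono_left nhdsWithin_le_nhds
          have hlim2 : Tendsto (fun w => C * ‖w - c‖ ^ (-(1 / 2) : ℝ)) (𝓝[{z : ℂ | 0 < z.im}] z)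
              (𝓝 (C * ‖z - c‖ ^ (-(1 / 2) : ℝ))) := by
            have hpos : ‖z - c‖ ≠ 0 := norm_ne_zero_iff.2 (sub_ne_zero.2 hzc)
            have : ContinuousAt (fun w => C * ‖w - c‖ ^ (-(1 / 2) : ℝ)) z :=
              ContinuousAt.mul continuousAt_const
                (((continuousAt_id.sub continuousAt_const).norm).rpow_const (Or.inl hpos))
            exact this.tendsto.mono_left nhdsWithin_le_nhds
          have hne : (𝓝[{z : ℂ | 0 < z.im}] z).NeBot := by
            rw [hsplit z hz0]
            exact neBot_nhdsWithin_im_pos _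
          refine le_of_tendsto_of_tendsto hlim.norm hlim2 ?_
          filter_upwards [hz.filter_mono nhdsWithin_le_nhds, self_mem_nhdsWithin] with w hw hw0
          have hw1 : w.im ≠ 0 := ne_of_gt hw0
          rw [hgf w hw1]
          exact hw hw1
        · rw [hgf z hz0]
          exact hz.self_of_nhds hz0
    obtain ⟨C, hC⟩ := hbound
    have hO : g =O[𝓝[≠] c] fun z => ‖z - c‖ ^ (-(1 / 2) : ℝ) := by
      refine Asymptotics.IsBigO.of_bound C ?_
      filter_upwards [hC] with z hz
      rwa [Real.norm_of_nonneg (by positivity)]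
    refine hO.trans_isLittleO ?_
    rw [← Asymptotics.isLittleO_norm_right, Asymptotics.isLittleO_iff_tendsto']
    · have h1 : Tendsto (fun z => ‖z - c‖ ^ (1 / 2 : ℝ)) (𝓝[≠] c) (𝓝 0) := by
        have h2 : ContinuousAt (fun z => ‖z - c‖ ^ (1 / 2 : ℝ)) c :=
          ((continuousAt_id.sub continuousAt_const).norm).rpow_const (Or.inr (by norm_num))
        have h3 := h2.tendsto
        rw [sub_self, norm_zero, Real.zero_rpow (by norm_num)] at h3
        exact h3.mono_left nhdsWithin_le_nhds
      refine h1.congr' ?_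
      filter_upwards [self_mem_nhdsWithin] with z hz
      have hpos : 0 < ‖z - c‖ := norm_pos_iff.2 (sub_ne_zero.2 hz)
      rw [norm_inv, div_inv_eq_mul, ← Real.rpow_add_one hpos.ne']
      norm_num
    · filter_upwards [self_mem_nhdsWithin] with z hz h
      exact absurd (norm_eq_zero.1 h) (inv_ne_zero (sub_ne_zero.2 hz))
  set F : ℂ → ℂ := fun c => limUnder (𝓝[≠] c) g with hF
  have hFg : ∀ z ∈ Ω, F z = g z := fun z hz =>
    (((hgc.continuousAt (hΩo.mem_nhds hz)).tendsto.mono_left nhdsWithin_le_nhds)).limUnder_eq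
  refine ⟨F, fun c => ?_, fun z hz => ?_⟩
  · have hd := Complex.differentiableOn_update_limUnder_insert_of_isLittleO (hpunct c) hgd
      (hlittle c)
    have hn : insert c Ω ∈ 𝓝 c := insert_mem_nhds_iff.2 (hpunct c)
    refine (hd.differentiableAt hn).congr_of_eventuallyEq ?_
    filter_upwards [hn] with z hz
    by_cases hzc : z = c
    · rw [hzc, Function.update_self]
    · rw [Function.update_of_ne hzc, hFg z (hz.resolve_left hzc)]
  · rw [hFg z fun h => absurd h hz, hgf z hz]

/-- Maximum principle on a sequence of squares. -/
theorem eq_zero_of_squares {F : ℂ → ℂ} (hF : Differentiable ℂ F) {a : ℕ → ℝ}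
    (ha : Tendsto a atTop atTop) {C : ℝ} (hC : ∀ᶠ n in atTop, ∀ z : ℂ, z.im ≠ 0 →
      (|z.re| = a n ∧ |z.im| ≤ a n) ∨ (|z.im| = a n ∧ |z.re| ≤ a n) → ‖F z‖ ≤ C / a n) (z : ℂ) :
    F z = 0 := by
  have hlim : Tendsto (fun n => C / a n) atTop (𝓝 0) := ha.const_div_atTop C
  rw [← norm_le_zero_iff]
  refine ge_of_tendsto hlim ?_
  filter_upwards [hC, ha.eventually_gt_atTop (|z.re| + |z.im|)] with n hn hz
  have hre := abs_nonneg z.re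
  have him := abs_nonneg z.im
  have han : 0 < a n := by linarith
  set Q : Set ℂ := Set.Ioo (-a n) (a n) ×ℂ Set.Ioo (-a n) (a n) with hQ
  have hb : Bornology.IsBounded Q := (Metric.isBounded_Ioo _ _).reProdIm (Metric.isBounded_Ioo _ _)
  have hzQ : z ∈ closure Q :=
    subset_closure ⟨abs_lt.1 (by linarith), abs_lt.1 (by linarith)⟩
  have hne : -a n ≠ a n := by linarith
  refine Complex.norm_le_of_forall_mem_frontier_norm_le hb hF.diffContOnCl (fun w hw => ?_) hzQ
  rw [hQ, Complex.frontier_reProdIm, closure_Ioo hne, frontier_Ioo (by linarith)] at hw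
  have hw' : (|w.re| = a n ∧ |w.im| ≤ a n) ∨ (|w.im| = a n ∧ |w.re| ≤ a n) := by
    rcases hw with ⟨h1, h2⟩ | ⟨h1, h2⟩
    · refine Or.inr ⟨?_, abs_le.2 h1⟩
      rcases h2 with h2 | h2 <;> rw [h2] <;> simp [abs_of_pos han]
    · refine Or.inl ⟨?_, abs_le.2 h2⟩
      rcases h1 with h1 | h1 <;> rw [h1] <;> simp [abs_of_pos han]
  by_cases hw0 : w.im = 0
  · -- the two real points of the square are limits of other boundary points
    have hwre : |w.re| = a n := by
      rcases hw' with h | h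
      · exact h.1
      · rw [hw0, abs_zero] at h
        linarith [h.1]
    have hcont : Tendsto (fun y : ℝ => F (w.re + y * Complex.I)) (𝓝[>] 0) (𝓝 (F w)) := by
      have h1 : Continuous fun y : ℝ => F (w.re + y * Complex.I) :=
        hF.continuous.comp (by fun_prop)
      have h2 : (w.re : ℂ) + (0 : ℝ) * Complex.I = w := by
        apply Complex.ext <;> simp [hw0]
      have h3 := h1.tendsto 0
      rw [h2] at h3
      exact h3.mono_left nhdsWithin_le_nhds
    refine le_of_tendsto hcont.norm ?_
    filter_upwards [Ioo_mem_nhdsGT han] with y hy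
    refine hn _ (by simpa using hy.1.ne') (Or.inl ⟨by simpa using hwre, ?_⟩)
    simpa [abs_of_pos hy.1] using hy.2.le
  · exact hn w hw0 hw'

end RealLine

/-! ### Splitting of convergent infinite products -/

theorem ne_zero_of_hasProd_ne_zero {ι : Type*} {f : ι → ℂ} {P : ℂ} (h : HasProd f P) (hP : P ≠ 0)
    (i : ι) : f i ≠ 0 := by
  intro hi
  refine hP (tendsto_nhds_unique h (tendsto_const_nhds.congr' ?_))
  filter_upwards [eventually_ge_atTop {i}] with s hs
  exact (Finset.prod_eq_zero (Finset.singleton_subset_iff.1 hs) hi).symm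

/-- A subproduct of a convergent product with non-zero value converges, because `ℂˣ` is a complete
topological group. -/
theorem multipliable_of_hasProd_ne_zero {ι κ : Type*} {f : ι → ℂ} {P : ℂ} (h : HasProd f P)
    (hP : P ≠ 0) {e : κ → ι} (he : Function.Injective e) : Multipliable (f ∘ e) := by
  let F : ι → ℂˣ := fun i => Units.mk0 (f i) (ne_zero_of_hasProd_ne_zero h hP i)
  have hF : HasProd F (Units.mk0 P hP) :=
    (Units.isEmbedding_val₀.isInducing.hasProd_iff (G := ℂˣ →* ℂ) (g := Units.coeHom ℂ) F _).1 h
  let : UniformSpace ℂˣ := IsTopologicalGroup.rightUniformSpace ℂˣ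
  have : IsUniformGroup ℂˣ := isUniformGroup_of_commGroup
  have : CompleteSpace ℂˣ :=
    IsRightUniformGroup.completeSpace_of_weaklyLocallyCompactSpace
  exact (hF.multipliable.comp_injective he).map (Units.coeHom ℂ) Units.continuous_val

/-- A convergent product with non-zero value over the disjoint union of three sets is the product
of the three subproducts. -/
theorem hasProd_eq_tprod_mul_tprod_mul_tprod {ι : Type*} {f : ι → ℂ} {s t u : Set ι} {P : ℂ}
    (h : HasProd (fun i : ↥(s ∪ t ∪ u) => f i) P) (hP : P ≠ 0) (hst : Disjoint s t)
    (hu : Disjoint (s ∪ t) u) :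
    P = (∏' i : s, f i) * (∏' i : t, f i) * ∏' i : u, f i := by
  have hsub : ∀ v : Set ι, v ⊆ s ∪ t ∪ u → HasProd (f ∘ ((↑) : v → ι)) (∏' i : v, f i) :=
    fun v hv => (multipliable_of_hasProd_ne_zero h hP (Set.inclusion_injective hv)).hasProd
  have hs := hsub s (Set.subset_union_left.trans Set.subset_union_left)
  have ht := hsub t (Set.subset_union_right.trans Set.subset_union_left)
  have hu' := hsub u Set.subset_union_right
  exact h.unique ((hs.mul_disjoint hst ht).mul_disjoint hu hu')

section Factorization

variable {q : ℝ → ℂ} {L : ℝ}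

theorem dirichletSpectrum_eq_union : dirichletSpectrum q L =
    dirichletWithSign q L 0 ∪ dirichletWithSign q L 1 ∪ dirichletWithSign q L (-1) := by
  ext μ
  simp only [dirichletWithSign, Set.mem_union, Set.mem_ofPred_eq]
  rcases dirichletSign q L μ with _ | _ | _ <;> simp

theorem disjoint_dirichletWithSign {s t : SignType} (h : s ≠ t) :
    Disjoint (dirichletWithSign q L s) (dirichletWithSign q L t) :=
  Set.disjoint_left.2 fun _ hs ht => h (hs.2.symm.trans ht.2)

/-- Off the zeros of `ỹ₁₂(L, ·)`, the Hadamard factorization reads `2 f⁰ f⁺ f⁻ = ỹ₁₂(L, ·)`. -/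
theorem fZero_mul_signProduct (h : ∃ AB : ℂ × ℂ, IsHadamardPair q L AB) {z : ℂ}
    (hz : modifiedSolution q L z 0 1 ≠ 0) :
    fZero q L z * (signProduct q L 1 z * signProduct q L (-1) z) =
      modifiedSolution q L z 0 1 / 2 := by
  obtain ⟨P, hP, he⟩ := h.choose_spec z
  have hP0 : P ≠ 0 := fun h0 => hz (by rw [he, h0, mul_zero])
  rw [dirichletSpectrum_eq_union] at hP
  have := hasProd_eq_tprod_mul_tprod_mul_tprod (f := fun μ => elementaryFactor μ z) hP hP0
    (disjoint_dirichletWithSign (by decide)) (Disjoint.union_left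
      (disjoint_dirichletWithSign (by decide)) (disjoint_dirichletWithSign (by decide)))
  rw [he, this, fZero, hadamardExp, dif_pos h, signProduct, signProduct, signProduct]
  ring

end Factorization

/-! ### Spectral gaps -/

/-- The zeros of an entire function on the real line are isolated. -/
theorem eventually_ofReal_ne_zero {f : ℂ → ℂ} (hf : Differentiable ℂ f) {z₀ : ℂ} (h : f z₀ ≠ 0)
    (t : ℝ) : ∀ᶠ s in 𝓝[≠] t, f (s : ℝ) ≠ 0 := by
  have han : AnalyticOnNhd ℂ f Set.univ :=
    (hf.differentiableOn (s := Set.univ)).analyticOnNhd isOpen_univ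
  have h1 : ∀ᶠ z in 𝓝[≠] (t : ℂ), f z ≠ 0 := by
    rcases (han t trivial).eventually_eq_zero_or_eventually_ne_zero with h0 | h0
    · exact absurd (han.eqOn_zero_of_preconnected_of_eventuallyEq_zero isPreconnected_univ
        trivial h0 (Set.mem_univ z₀)) h
    · exact h0
  have h2 : Tendsto (fun s : ℝ => (s : ℂ)) (𝓝[≠] t) (𝓝[≠] (t : ℂ)) := by
    refine tendsto_nhdsWithin_iff.2
      ⟨(Complex.continuous_ofReal.tendsto t).mono_left nhdsWithin_le_nhds, ?_⟩
    filter_upwards [self_mem_nhdsWithin] with s hs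
    simpa using hs
  exact h2.eventually h1

section Gaps

variable {q : ℝ → ℂ} {L K : ℝ}

theorem ofReal_mem_laxSpectrum_iff (hL : 0 ≤ L) (hq : IsRegularPotential q L K) (t : ℝ) :
    (t : ℂ) ∈ laxSpectrum q L ↔ ‖discriminant q L t‖ ≤ 1 := by
  constructor
  · rintro ⟨r, hr, he⟩
    rw [he, Complex.norm_real, Real.norm_eq_abs]
    exact abs_le.2 hr
  · intro h
    have he : discriminant q L t = ((discriminant q L t).re : ℂ) := by
      apply Complex.ext <;> simp [discriminant_ofReal_im hL hq t]
    rw [he, Complex.norm_real, Real.norm_eq_abs] at h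
    exact ⟨_, abs_le.1 h, he⟩

namespace GapLabelling

variable (G : GapLabelling q L)

theorem hi_lt_lo_of_lt {k l : ℤ} (hk : k ∈ G.idx) (hl : l ∈ G.idx) (h : k < l) :
    G.hi k < G.lo l := by
  have key : ∀ n : ℕ, k + 1 + n ∈ G.idx → G.hi k < G.lo (k + 1 + n) := by
    intro n
    induction n with
    | zero =>
      intro hn
      simpa using G.hi_lt_lo k hk (by simpa using hn)
    | succ n ih =>
      intro hn
      have hmem : k + 1 + n ∈ G.idx := G.ordConnected.out hk hn ⟨by lia, by push_cast; lia⟩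
      have hn' : k + 1 + n + 1 ∈ G.idx := by
        have e : k + 1 + ((n + 1 : ℕ) : ℤ) = k + 1 + n + 1 := by push_cast; ring
        rwa [e] at hn
      have h1 := G.hi_lt_lo _ hmem hn'
      have h2 := G.lo_lt_hi _ hmem
      have e : k + 1 + ((n + 1 : ℕ) : ℤ) = k + 1 + n + 1 := by push_cast; ring
      rw [e]
      linarith [ih hmem]
  obtain ⟨n, hn⟩ := Int.eq_ofNat_of_zero_le (show 0 ≤ l - (k + 1) by lia)
  have e : l = k + 1 + n := by lia
  rw [e]
  exact key n (e ▸ hl)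

theorem hi_injOn : Set.InjOn G.hi G.idx := by
  intro k hk l hl h
  rcases lt_trichotomy k l with hkl | hkl | hkl
  · linarith [G.hi_lt_lo_of_lt hk hl hkl, G.lo_lt_hi l hl]
  · exact hkl
  · linarith [G.hi_lt_lo_of_lt hl hk hkl, G.lo_lt_hi k hk]

theorem edge_notMem_gap {e : ℝ} (he : e ∈ G.edges) {l : ℤ} (hl : l ∈ G.idx) :
    e ∉ Set.Ioo (G.lo l) (G.hi l) := by
  obtain ⟨k, hk, he⟩ := he
  rintro ⟨h1, h2⟩
  have hlk := G.lo_lt_hi k hk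
  rcases lt_trichotomy k l with hkl | hkl | hkl
  · have := G.hi_lt_lo_of_lt hk hl hkl
    rcases he with rfl | rfl <;> linarith
  · subst hkl
    rcases he with rfl | rfl <;> linarith
  · have := G.hi_lt_lo_of_lt hl hk hkl
    rcases he with rfl | rfl <;> linarith

variable (hL : 0 ≤ L) (hq : IsRegularPotential q L K)

include hL hq in
theorem one_lt_norm_discriminant {k : ℤ} (hk : k ∈ G.idx) {t : ℝ}
    (ht : t ∈ Set.Ioo (G.lo k) (G.hi k)) : 1 < ‖discriminant q L t‖ := by
  have h : t ∈ {t : ℝ | (t : ℂ) ∉ laxSpectrum q L} := by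
    rw [G.gaps]
    exact Set.mem_biUnion hk ht
  rwa [Set.mem_ofPred_eq, ofReal_mem_laxSpectrum_iff hL hq, not_le] at h

include hL hq in
theorem one_le_norm_discriminant {k : ℤ} (hk : k ∈ G.idx) {t : ℝ}
    (ht : t ∈ Set.Icc (G.lo k) (G.hi k)) : 1 ≤ ‖discriminant q L t‖ := by
  have hc : Continuous fun t : ℝ => ‖discriminant q L t‖ :=
    ((differentiable_discriminant hL hq).continuous.comp Complex.continuous_ofReal).norm
  rw [← closure_Ioo (G.lo_lt_hi k hk).ne] at ht
  exact closure_minimal (fun s hs => (G.one_lt_norm_discriminant hL hq hk hs).le)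
    (isClosed_le continuous_const hc) ht

include hL hq in
theorem discriminant_sq_edge {e : ℝ} (he : e ∈ G.edges) : discriminant q L e ^ 2 - 1 = 0 := by
  have h1 : ‖discriminant q L e‖ ≤ 1 := by
    rw [← ofReal_mem_laxSpectrum_iff hL hq]
    by_contra h
    have h' : e ∈ {t : ℝ | (t : ℂ) ∉ laxSpectrum q L} := h
    rw [G.gaps] at h'
    obtain ⟨l, hl, h''⟩ := Set.mem_iUnion₂.1 h'
    exact G.edge_notMem_gap he hl h''
  have h2 : 1 ≤ ‖discriminant q L e‖ := by
    obtain ⟨k, hk, he⟩ := he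
    have hlt := (G.lo_lt_hi k hk).le
    rcases he with rfl | rfl
    · exact G.one_le_norm_discriminant hL hq hk ⟨le_rfl, hlt⟩
    · exact G.one_le_norm_discriminant hL hq hk ⟨hlt, le_rfl⟩
  have he : discriminant q L e = ((discriminant q L e).re : ℂ) := by
    apply Complex.ext <;> simp [discriminant_ofReal_im hL hq e]
  have h3 := le_antisymm h1 h2
  rw [he, Complex.norm_real, Real.norm_eq_abs] at h3
  rw [he, ← Complex.ofReal_pow, ← sq_abs, h3]
  simp

include hL hq in
theorem eventually_notMem_edges (t : ℝ) : ∀ᶠ s in 𝓝[≠] t, s ∉ G.edges := by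
  obtain ⟨k, hk⟩ := G.nonempty
  have hlt := G.lo_lt_hi k hk
  have hmid := G.one_lt_norm_discriminant hL hq hk (t := (G.lo k + G.hi k) / 2)
    ⟨by linarith, by linarith⟩
  have hne : discriminant q L ((G.lo k + G.hi k) / 2 : ℝ) ^ 2 - 1 ≠ 0 := by
    intro h
    have h1 := congrArg norm (sub_eq_zero.1 h)
    rw [norm_pow, norm_one] at h1
    nlinarith
  have hd : Differentiable ℂ fun z => discriminant q L z ^ 2 - 1 :=
    ((differentiable_discriminant hL hq).pow 2).sub_const 1
  filter_upwards [eventually_ofReal_ne_zero hd hne t] with s hs hse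
  exact hs (G.discriminant_sq_edge hL hq hse)

include hL hq in
theorem finite_hi_mem_Icc (a b : ℝ) : {k | k ∈ G.idx ∧ G.hi k ∈ Set.Icc a b}.Finite := by
  have hfin : (G.edges ∩ Set.Icc a b).Finite := by
    by_contra h
    obtain ⟨t, -, ht⟩ := Set.Infinite.exists_accPt_of_subset_isCompact h isCompact_Icc
      Set.inter_subset_right
    rw [accPt_iff_frequently_nhdsNE] at ht
    refine ht ?_
    filter_upwards [G.eventually_notMem_edges hL hq t] with s hs hs'
    exact hs hs'.1
  refine Set.Finite.of_finite_image (f := G.hi) (hfin.subset ?_) (G.hi_injOn.mono fun k hk => hk.1)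
  rintro _ ⟨k, hk, rfl⟩
  exact ⟨⟨k, hk.1, Or.inr rfl⟩, hk.2⟩

include hL hq in
/-- The cells cover the real line up to the band edges. -/
theorem exists_mem_cell {t : ℝ} (ht : t ∉ G.edges) : ∃ n, t ∈ G.cell n := by
  have hne : ∀ k ∈ G.idx, G.hi k ≠ t := fun k hk h => ht ⟨k, hk, Or.inr h.symm⟩
  have hmono : ∀ k ∈ G.idx, ∀ l ∈ G.idx, k ≤ l → G.hi k ≤ G.hi l := by
    intro k hk l hl hkl
    rcases hkl.lt_or_eq with h | h
    · linarith [G.hi_lt_lo_of_lt hk hl h, G.lo_lt_hi l hl]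
    · rw [h]
  by_cases hA : ∃ k ∈ G.idx, t < G.hi k
  · obtain ⟨k₀, hk₀, ht₀⟩ := hA
    -- the first gap that ends to the right of `t`; there is one since edges do not accumulate
    obtain ⟨b, hb⟩ := (G.finite_hi_mem_Icc hL hq t (G.hi k₀)).bddBelow
    obtain ⟨n, ⟨hn, htn⟩, hmin⟩ := Int.exists_least_of_bdd
      (P := fun k => k ∈ G.idx ∧ t < G.hi k)
      ⟨min b k₀, fun k hk => by
        rcases le_total k k₀ with h | h
        · exact (min_le_left _ _).trans (hb ⟨hk.1, hk.2.le, hmono k hk.1 k₀ hk₀ h⟩)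
        · exact (min_le_right _ _).trans h⟩ ⟨k₀, hk₀, ht₀⟩
    refine ⟨n, Or.inl hn, fun _ => htn, fun hn1 => ?_, ht⟩
    by_contra h
    have := hmin (n - 1) ⟨hn1, lt_of_le_of_ne (not_lt.1 h) (hne _ hn1).symm⟩
    lia
  · have hA' : ∀ k ∈ G.idx, G.hi k < t := fun k hk =>
      lt_of_le_of_ne (not_lt.1 fun h => hA ⟨k, hk, h⟩) (hne k hk)
    obtain ⟨k₀, hk₀⟩ := G.nonempty
    -- all gaps lie to the left of `t`, hence there is a last gap, and `t` is in the band after it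
    obtain ⟨b, hb⟩ := (G.finite_hi_mem_Icc hL hq (G.hi k₀) t).bddAbove
    obtain ⟨n, hn, hmax⟩ := Int.exists_greatest_of_bdd (P := fun k => k ∈ G.idx)
      ⟨max b k₀, fun k hk => by
        rcases le_total k₀ k with h | h
        · exact (hb ⟨hk, hmono k₀ hk₀ k hk h, (hA' k hk).le⟩).trans (le_max_left _ _)
        · exact h.trans (le_max_right _ _)⟩ ⟨k₀, hk₀⟩
    refine ⟨n + 1, Or.inr (by simpa using hn), fun h => ?_, fun _ => ?_, ht⟩
    · have := hmax _ h
      lia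
    · simpa using hA' n hn

end GapLabelling

end Gaps

/-! ### Squares that avoid the gaps -/

/-- Half the side length of the `n`-th square; `cos (L a) = 0`. -/
def squareSize (L : ℝ) (n : ℕ) : ℝ := (Real.pi * n + Real.pi / 2) / L

/-- The non-real points of the boundary of the square with half side length `a`. -/
def squareBoundary (a : ℝ) : Set ℂ :=
  {z | z.im ≠ 0 ∧ ((|z.re| = a ∧ |z.im| ≤ a) ∨ (|z.im| = a ∧ |z.re| ≤ a))}

theorem tendsto_squareSize {L : ℝ} (hL : 0 < L) : Tendsto (squareSize L) atTop atTop :=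
  ((tendsto_natCast_atTop_atTop.const_mul_atTop Real.pi_pos).atTop_add
    tendsto_const_nhds).atTop_div_const hL

theorem le_norm_of_mem_squareBoundary {a : ℝ} {z : ℂ} (hz : z ∈ squareBoundary a) : a ≤ ‖z‖ := by
  rcases hz.2 with h | h
  · exact h.1 ▸ Complex.abs_re_le_norm z
  · exact h.1 ▸ Complex.abs_im_le_norm z

theorem cos_squareSize_mul {L : ℝ} (hL : 0 < L) (n : ℕ) : Real.cos (squareSize L n * L) = 0 := by
  rw [squareSize, div_mul_cancel₀ _ hL.ne', Real.cos_add_pi_div_two, mul_comm, Real.sin_nat_mul_pi,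
    neg_zero]

theorem norm_sin_sq (w : ℂ) : ‖Complex.sin w‖ ^ 2 = Real.sin w.re ^ 2 + Real.sinh w.im ^ 2 := by
  have h1 : Complex.sin w = ((Real.sin w.re * Real.cosh w.im : ℝ) : ℂ) +
      ((Real.cos w.re * Real.sinh w.im : ℝ) : ℂ) * Complex.I := by
    rw [Complex.sin_eq]
    push_cast
    ring
  rw [h1, Complex.sq_norm, Complex.normSq_add_mul_I]
  have h2 := Real.sin_sq_add_cos_sq w.re
  have h3 := Real.cosh_sq w.im
  linear_combination Real.sin w.re ^ 2 * h3 + Real.sinh w.im ^ 2 * h2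

theorem exp_le_norm_sin_of_mem_squareBoundary {L : ℝ} (hL : 0 < L) {n : ℕ} {z : ℂ}
    (hz : z ∈ squareBoundary (squareSize L n)) :
    Real.exp (|z.im| * L) ≤ 4 * ‖Complex.sin (z * L)‖ := by
  have hre : (z * L).re = z.re * L := by simp
  have him : (z * L).im = z.im * L := by simp
  have hs := norm_sin_sq (z * L)
  rw [hre, him] at hs
  have habs : |z.im * L| = |z.im| * L := by rw [abs_mul, abs_of_pos hL]
  have hE := Real.exp_pos (|z.im| * L)
  have hE' := Real.exp_pos (-(|z.im| * L))
  suffices h : (Real.exp (|z.im| * L) / 4) ^ 2 ≤ ‖Complex.sin (z * L)‖ ^ 2 by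
    have := (pow_le_pow_iff_left₀ (by positivity) (norm_nonneg _) two_ne_zero).1 h
    linarith
  rw [hs]
  rcases hz.2 with ⟨h, -⟩ | ⟨h, -⟩
  · have hcos : Real.cos (z.re * L) = 0 := by
      rw [← Real.cos_abs, abs_mul, abs_of_pos hL, h, cos_squareSize_mul hL]
    have hsin : Real.sin (z.re * L) ^ 2 = 1 := by
      have := Real.sin_sq_add_cos_sq (z.re * L)
      rw [hcos] at this
      linarith
    have hch := Real.cosh_sq (z.im * L)
    have : Real.exp (|z.im| * L) / 4 ≤ Real.cosh (z.im * L) := by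
      rw [← Real.cosh_abs, habs, Real.cosh_eq]
      linarith
    rw [hsin, add_comm, ← hch]
    gcongr
  · have h1 : 1 ≤ |z.im| * L := by
      rw [h, squareSize, div_mul_cancel₀ _ hL.ne']
      have := Real.pi_gt_three
      have : 0 ≤ Real.pi * n := by positivity
      linarith
    have h2 : Real.exp (-(|z.im| * L)) ≤ 1 := Real.exp_le_one_iff.2 (by linarith)
    have h3 : 2 ≤ Real.exp (|z.im| * L) := by
      have := Real.add_one_le_exp (|z.im| * L)
      linarith
    have h4 : Real.exp (|z.im| * L) / 4 ≤ Real.sinh (|z.im| * L) := by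
      rw [Real.sinh_eq]
      linarith
    have h5 : Real.sinh (z.im * L) ^ 2 = Real.sinh (|z.im| * L) ^ 2 := by
      rw [← habs]
      rcases abs_choice (z.im * L) with h | h <;> rw [h]
      rw [Real.sinh_neg, neg_sq]
    rw [h5]
    have : (Real.exp (|z.im| * L) / 4) ^ 2 ≤ Real.sinh (|z.im| * L) ^ 2 := by gcongr
    nlinarith [sq_nonneg (Real.sin (z.re * L))]

/-- Near the vertical sides of a large square, `|Δ| < 1` on the real line, hence there are no
gaps. -/
theorem exists_le_norm_sub_of_mem_squareBoundary {q : ℝ → ℂ} {L K : ℝ} (hL : 0 < L)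
    (hq : IsRegularPotential q L K) (G : GapLabelling q L) :
    ∀ᶠ n in atTop, ∀ z ∈ squareBoundary (squareSize L n), ∀ k ∈ G.idx,
      ∀ t ∈ Set.Icc (G.lo k) (G.hi k), 1 / (4 * L) ≤ ‖z - (t : ℂ)‖ := by
  obtain ⟨ρ, hρ, h⟩ := exists_norm_discriminant_lt_one hL.le hq
  filter_upwards [(tendsto_squareSize hL).eventually_ge_atTop (ρ + 1 / (4 * L))]
    with n hn z hz k hk t ht
  have hε : 0 < 1 / (4 * L) := by positivity
  rcases hz.2 with ⟨hre, -⟩ | ⟨him, -⟩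
  · by_contra hlt
    rw [not_le] at hlt
    have h1 : |z.re - t| < 1 / (4 * L) := by
      have := Complex.abs_re_le_norm (z - (t : ℂ))
      rw [Complex.sub_re, Complex.ofReal_re] at this
      linarith
    have h2 : ρ ≤ |t| := by
      have := abs_sub_abs_le_abs_sub z.re t
      linarith
    have hcos : Real.cos (z.re * L) = 0 := by
      rw [← Real.cos_abs, abs_mul, abs_of_pos hL, hre, cos_squareSize_mul hL]
    have h3 : |Real.cos (t * L)| ≤ 1 / 4 := by
      have e : t * L = z.re * L - (z.re - t) * L := by ring
      rw [e, Real.cos_sub, hcos, zero_mul, zero_add, abs_mul]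
      have h4 : |Real.sin ((z.re - t) * L)| ≤ |(z.re - t) * L| := Real.abs_sin_le_abs
      have h5 : |(z.re - t) * L| ≤ 1 / 4 := by
        rw [abs_mul, abs_of_pos hL]
        have : |z.re - t| * L ≤ 1 / (4 * L) * L := by gcongr
        have e2 : 1 / (4 * L) * L = 1 / 4 := by field_simp
        linarith
      have h6 := Real.abs_sin_le_one (z.re * L)
      nlinarith [abs_nonneg (Real.sin (z.re * L)), abs_nonneg (Real.sin ((z.re - t) * L))]
    exact absurd (G.one_le_norm_discriminant hL.le hq hk ht) (not_le.2 (h t h2 h3))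
  · have := Complex.abs_im_le_norm (z - (t : ℂ))
    rw [Complex.sub_im, Complex.ofReal_im, sub_zero, him] at this
    linarith

/-! ### The Riemann-Hilbert problem -/

theorem norm_mul_apply_le {A B : Mat2} {a b : ℝ} (hA : ∀ i j, ‖A i j‖ ≤ a)
    (hB : ∀ i j, ‖B i j‖ ≤ b) (i j : Fin 2) : ‖(A * B) i j‖ ≤ 2 * (a * b) := by
  have ha : 0 ≤ a := (norm_nonneg _).trans (hA 0 0)
  rw [Matrix.mul_apply, Fin.sum_univ_two]
  refine (norm_add_le _ _).trans ?_
  rw [norm_mul, norm_mul, two_mul]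
  gcongr <;> first | exact hA _ _ | exact hB _ _

theorem norm_adjugate_apply_le {A : Mat2} {a : ℝ} (hA : ∀ i j, ‖A i j‖ ≤ a) (i j : Fin 2) :
    ‖A.adjugate i j‖ ≤ a := by
  rw [Matrix.adjugate_fin_two]
  fin_cases i <;> fin_cases j <;> simp [hA]

theorem norm_U_apply_le (i j : Fin 2) : ‖U i j‖ ≤ 1 := by
  fin_cases i <;> fin_cases j <;> simp [U]

theorem det_U : U.det = 2 * Complex.I := by
  rw [U, Matrix.det_fin_two_of]
  ring

theorem mul_mul_adjugate_mul (A B V : Mat2) :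
    A * V * (B * V).adjugate = V.det • (A * B.adjugate) := by
  rw [Matrix.adjugate_mul_distrib, Matrix.mul_assoc, ← Matrix.mul_assoc V, Matrix.mul_adjugate,
    Matrix.smul_mul, Matrix.one_mul, Matrix.mul_smul]

theorem eq_of_sub_mul_adjugate_eq_zero {A B : Mat2} (hB : B.det ≠ 0)
    (h : (A - B) * B.adjugate = 0) : A = B := by
  have h1 : (A - B) * B.adjugate * B = 0 := by rw [h, Matrix.zero_mul]
  rw [Matrix.mul_assoc, Matrix.adjugate_mul, Matrix.mul_smul, Matrix.mul_one] at h1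
  exact sub_eq_zero.1 ((smul_eq_zero.1 h1).resolve_left hB)

theorem det_one_add_ne_zero {N : Mat2} (hN : ∀ i j, ‖N i j‖ ≤ 1 / 4) : (1 + N).det ≠ 0 := by
  intro h
  rw [Matrix.det_fin_two] at h
  simp only [Matrix.add_apply, Matrix.one_apply_eq, ne_eq, zero_ne_one, one_ne_zero,
    not_false_eq_true, Matrix.one_apply_ne, zero_add] at h
  have h1 : (1 : ℂ) = -(N 0 0 + N 1 1 + N 0 0 * N 1 1 - N 0 1 * N 1 0) := by
    linear_combination h
  have h2 : ‖N 0 0 * N 1 1‖ ≤ 1 / 16 := by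
    rw [norm_mul]
    nlinarith [hN 0 0, hN 1 1, norm_nonneg (N 0 0), norm_nonneg (N 1 1)]
  have h3 : ‖N 0 1 * N 1 0‖ ≤ 1 / 16 := by
    rw [norm_mul]
    nlinarith [hN 0 1, hN 1 0, norm_nonneg (N 0 1), norm_nonneg (N 1 0)]
  have h4 : (1 : ℝ) ≤ ‖N 0 0‖ + ‖N 1 1‖ + ‖N 0 0 * N 1 1‖ + ‖N 0 1 * N 1 0‖ := by
    rw [← norm_one (α := ℂ), h1, norm_neg]
    refine (norm_sub_le _ _).trans ?_
    gcongr
    refine (norm_add_le _ _).trans ?_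
    gcongr
    exact norm_add_le _ _
  linarith [hN 0 0, hN 1 1]

section

variable {q : ℝ → ℂ} {L K : ℝ} {G : GapLabelling q L} {r₀ r₄ : ℂ → ℂ} {x : ℝ}

theorem signProduct_ne_zero (h : ∃ AB : ℂ × ℂ, IsHadamardPair q L AB) {z : ℂ}
    (hz : modifiedSolution q L z 0 1 ≠ 0) :
    signProduct q L 1 z ≠ 0 ∧ signProduct q L (-1) z ≠ 0 := by
  have h0 : fZero q L z * (signProduct q L 1 z * signProduct q L (-1) z) ≠ 0 := by
    rw [fZero_mul_signProduct h hz]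
    exact div_ne_zero hz two_ne_zero
  exact mul_ne_zero_iff.1 (mul_ne_zero_iff.1 h0).2

theorem jumpSign_mul_self (G : GapLabelling q L) (n : ℤ) (t : ℝ) :
    G.jumpSign n t * G.jumpSign n t = 1 := by
  rw [GapLabelling.jumpSign]
  rcases Int.even_or_odd (n + (G.count t : ℤ)) with h | h
  · rw [h.neg_one_zpow, mul_one]
  · rw [h.neg_one_zpow, neg_mul_neg, mul_one]

theorem det_jump (h : ∃ AB : ℂ × ℂ, IsHadamardPair q L AB) {t : ℝ}
    (ht : modifiedSolution q L t 0 1 ≠ 0) (n : ℤ) : (G.jump n x t).det = 1 := by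
  have hs := jumpSign_mul_self G n t
  obtain ⟨h1, h2⟩ := signProduct_ne_zero h ht
  rw [GapLabelling.jump]
  split_ifs
  · rw [Matrix.det_smul, Matrix.det_fin_two_of, Fintype.card_fin]
    field_simp
    linear_combination hs
  · have he : Complex.exp (-2 * Complex.I * t * x) * Complex.exp (2 * Complex.I * t * x) = 1 := by
      rw [← Complex.exp_add, ← Complex.exp_zero]
      congr 1
      ring
    rw [Matrix.det_smul, Matrix.det_fin_two_of, Fintype.card_fin, he, mul_pow, Complex.I_sq]
    linear_combination hs

/-- The determinant of `B` is `± ỹ₁₂ / (2 √(Δ² - 1))`. -/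
theorem norm_det_matB_sq (h : ∃ AB : ℂ × ℂ, IsHadamardPair q L AB) (hr : IsRootBranch G r₀ r₄)
    {z : ℂ} (hz : z.im ≠ 0) (hM : modifiedSolution q L z 0 1 ≠ 0)
    (hD : discriminant q L z ^ 2 - 1 ≠ 0) :
    ‖(matB q L r₀ r₄ z).det‖ ^ 2 * ‖discriminant q L z ^ 2 - 1‖ =
      ‖modifiedSolution q L z 0 1‖ ^ 2 / 4 := by
  have h4 := hr.pow₄ z hz
  have h0 := hr.sq₀ z hz
  have hr4 : r₄ z ≠ 0 := fun h' => hD (by rw [← h4, h']; simp)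
  have hf := fZero_mul_signProduct h hM
  have hdet : ‖(matB q L r₀ r₄ z).det‖ =
      ‖r₀ z ^ 2 * (signProduct q L 1 z * signProduct q L (-1) z)‖ / ‖r₄ z‖ ^ 2 := by
    rw [matB]
    split_ifs
    · rw [Matrix.det_smul, Matrix.det_fin_two_of, Fintype.card_fin]
      simp only [norm_mul, norm_pow, norm_div, Complex.norm_I, mul_zero, sub_zero]
      ring
    · rw [Matrix.det_smul, Matrix.det_fin_two_of, Fintype.card_fin]
      simp only [norm_mul, norm_pow, norm_div, mul_zero, sub_zero]
      ring
  have hn : ‖r₄ z‖ ≠ 0 := norm_ne_zero_iff.2 hr4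
  rw [hdet, ← h4, h0, hf, norm_div, Complex.norm_two, norm_pow]
  field_simp
  norm_num

/-- On large squares, `ỹ₁₂` and `Δ² - 1` do not vanish and their ratio is controlled. -/
theorem eventually_squareBoundary (hL : 0 < L) (hq : IsRegularPotential q L K) :
    ∀ᶠ n in atTop, ∀ z ∈ squareBoundary (squareSize L n),
      modifiedSolution q L z 0 1 ≠ 0 ∧ discriminant q L z ^ 2 - 1 ≠ 0 ∧
      ‖modifiedSolution q L z 0 1‖ ^ 2 ≤ 128 * ‖discriminant q L z ^ 2 - 1‖ := by
  obtain ⟨ρ, -, h⟩ := exists_modifiedSolution_sq_le hL.le hq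
  filter_upwards [(tendsto_squareSize hL).eventually_ge_atTop ρ] with n hn z hz
  exact h z (hn.trans (le_norm_of_mem_squareBoundary hz))
    (exp_le_norm_sin_of_mem_squareBoundary hL hz)

theorem mk_mem_squareBoundary {a b : ℝ} (ha : 0 < a) (hb : |b| = a) :
    (⟨0, b⟩ : ℂ) ∈ squareBoundary a := by
  refine ⟨fun h => ?_, Or.inr ⟨hb, by simpa using ha.le⟩⟩
  have h' : b = 0 := h
  rw [h', abs_zero] at hb
  exact ha.ne hb

/-- `(Φ₁ - Φ₂) adj Φ₂` has no jump across the real line, because the jump matrix has determinant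
one. -/
theorem sub_mul_adjugate_boundary_eq (hL : 0 < L) (hq : IsRegularPotential q L K)
    (hH : ∃ AB : ℂ × ℂ, IsHadamardPair q L AB) {P₁ M₁ P₂ M₂ : ℝ → Mat2}
    (cP₁ : ContinuousOn P₁ G.edgesᶜ) (cM₁ : ContinuousOn M₁ G.edgesᶜ)
    (cP₂ : ContinuousOn P₂ G.edgesᶜ) (cM₂ : ContinuousOn M₂ G.edgesᶜ)
    (j₁ : ∀ n : ℤ, ∀ t ∈ G.cell n, P₁ t = M₁ t * G.jump n x t)
    (j₂ : ∀ n : ℤ, ∀ t ∈ G.cell n, P₂ t = M₂ t * G.jump n x t) {t : ℝ} (ht : t ∉ G.edges) :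
    (P₁ t - P₂ t) * (P₂ t).adjugate = (M₁ t - M₂ t) * (M₂ t).adjugate := by
  have hsq := G.eventually_notMem_edges hL.le hq t
  obtain ⟨n, hn, hn'⟩ := ((eventually_squareBoundary hL hq).and
    ((tendsto_squareSize hL).eventually_gt_atTop 0)).exists
  have hM0 := (hn ⟨0, squareSize L n⟩ (mk_mem_squareBoundary hn' (abs_of_pos hn'))).1
  -- at zeros of `ỹ₁₂` the jump relation is used only in the limit
  have hev : ∀ᶠ s in 𝓝[≠] t, (P₁ s - P₂ s) * (P₂ s).adjugate = (M₁ s - M₂ s) * (M₂ s).adjugate := by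
    filter_upwards [hsq, eventually_ofReal_ne_zero
      (differentiable_modifiedSolution_zero_one hL.le hq) hM0 t] with s hs hMs
    obtain ⟨m, hm⟩ := G.exists_mem_cell hL.le hq hs
    rw [j₁ m s hm, j₂ m s hm, ← Matrix.sub_mul, mul_mul_adjugate_mul, det_jump hH hMs, one_smul]
  have hnhds : G.edgesᶜ ∈ 𝓝 t := by
    rw [eventually_nhdsWithin_iff] at hsq
    filter_upwards [hsq] with s hs
    by_cases hst : s = t
    · rwa [hst]
    · exact hs hst
  have hc : ∀ {A B : ℝ → Mat2}, ContinuousOn A G.edgesᶜ → ContinuousOn B G.edgesᶜ →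
      Tendsto (fun s => (A s - B s) * (B s).adjugate) (𝓝[≠] t)
        (𝓝 ((A t - B t) * (B t).adjugate)) := by
    intro A B hA hB
    have hA' := hA.continuousAt hnhds
    have hB' := hB.continuousAt hnhds
    exact ((hA'.sub hB').mul (Continuous.matrix_adjugate continuous_id
      |>.continuousAt.comp hB')).tendsto.mono_left nhdsWithin_le_nhds
  exact tendsto_nhds_unique_of_eventuallyEq (hc cP₁ cP₂) (hc cM₁ cM₂) hev

/-- On large squares `(Φ₁ - Φ₂) adj Φ₂` is of order `1 / z`: the factors `B` combine to `det B`,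
which is bounded there, and the leading terms cancel. -/
theorem eventually_norm_sub_mul_adjugate_le (hL : 0 < L) (hq : IsRegularPotential q L K)
    (hH : ∃ AB : ℂ × ℂ, IsHadamardPair q L AB) (hr : IsRootBranch G r₀ r₄) {Φ₁ Φ₂ : ℂ → Mat2}
    (h₁ : IsRHPSolution G r₀ r₄ x Φ₁) (h₂ : IsRHPSolution G r₀ r₄ x Φ₂) :
    ∃ C : ℝ, ∀ᶠ n in atTop, ∀ z ∈ squareBoundary (squareSize L n), ∀ i j,
      ‖((Φ₁ z - Φ₂ z) * (Φ₂ z).adjugate) i j‖ ≤ C / squareSize L n := by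
  obtain ⟨C₁, R₁, a₁⟩ := h₁.asymptotics (1 / (4 * L)) (by positivity)
  obtain ⟨C₂, R₂, a₂⟩ := h₂.asymptotics (1 / (4 * L)) (by positivity)
  refine ⟨6 * (2 * (2 * (2 * (1 * (|C₁| + |C₂|)) * (1 + |C₂|)) * 1)), ?_⟩
  filter_upwards [eventually_squareBoundary hL hq,
    exists_le_norm_sub_of_mem_squareBoundary hL hq G,
    (tendsto_squareSize hL).eventually_ge_atTop (max (max R₁ R₂) 1)] with n hn hgap hbig z hz i j
  have hzn := le_norm_of_mem_squareBoundary hz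
  have ha1 : 1 ≤ squareSize L n := (le_max_right _ _).trans hbig
  have hz1 : 1 ≤ ‖z‖ := ha1.trans hzn
  obtain ⟨N₁, hN₁, e₁⟩ := a₁ z hz.1
    (((le_max_left _ _).trans (le_max_left _ _)).trans (hbig.trans hzn)) (hgap z hz)
  obtain ⟨N₂, hN₂, e₂⟩ := a₂ z hz.1
    (((le_max_right _ _).trans (le_max_left _ _)).trans (hbig.trans hzn)) (hgap z hz)
  obtain ⟨hM, hD, hMD⟩ := hn z hz
  -- `|det B|² ≤ 128 / 4`
  have hdet : ‖(matB q L r₀ r₄ z).det‖ ≤ 6 := by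
    have h := norm_det_matB_sq hH hr hz.1 hM hD
    have hDpos : 0 < ‖discriminant q L z ^ 2 - 1‖ := norm_pos_iff.2 hD
    have h6 : ‖(matB q L r₀ r₄ z).det‖ ^ 2 ≤ 6 ^ 2 := by
      by_contra hlt
      rw [not_le] at hlt
      nlinarith
    exact (pow_le_pow_iff_left₀ (norm_nonneg _) (by norm_num) two_ne_zero).1 h6
  have hD' : (Φ₁ z - Φ₂ z) * (Φ₂ z).adjugate = (matB q L r₀ r₄ z).det •
      (U * (N₁ - N₂) * (1 + N₂).adjugate * U.adjugate) := by
    rw [e₁, e₂, ← Matrix.sub_mul, mul_mul_adjugate_mul, ← Matrix.mul_sub, add_sub_add_left_eq_sub,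
      Matrix.adjugate_mul_distrib, ← Matrix.mul_assoc]
  have hle : ∀ C : ℝ, C / ‖z‖ ≤ |C| / squareSize L n := fun C => by
    have : 0 < squareSize L n := by linarith
    calc C / ‖z‖ ≤ |C| / ‖z‖ := by gcongr; exact le_abs_self C
      _ ≤ |C| / squareSize L n := by gcongr
  have b1 : ∀ i j, ‖(N₁ - N₂) i j‖ ≤ (|C₁| + |C₂|) / squareSize L n := fun i j => by
    rw [Matrix.sub_apply, add_div]
    exact (norm_sub_le _ _).trans
      (add_le_add ((hN₁ i j).trans (hle C₁)) ((hN₂ i j).trans (hle C₂)))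
  have b2 : ∀ i j, ‖(1 + N₂) i j‖ ≤ 1 + |C₂| := fun i j => by
    rw [Matrix.add_apply]
    refine (norm_add_le _ _).trans (add_le_add ?_ ?_)
    · fin_cases i <;> fin_cases j <;> simp
    · refine ((hN₂ i j).trans (hle C₂)).trans ?_
      exact div_le_self (abs_nonneg _) ha1
  rw [hD', Matrix.smul_apply, norm_smul]
  refine (mul_le_mul hdet (norm_mul_apply_le (norm_mul_apply_le
    (norm_mul_apply_le norm_U_apply_le b1) (norm_adjugate_apply_le b2))
    (norm_adjugate_apply_le norm_U_apply_le) i j) (norm_nonneg _) (by norm_num)).trans (le_of_eq ?_)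
  ring

/-- `(Φ₁ - Φ₂) adj Φ₂` vanishes, being the restriction of an entire function that tends to zero on
a sequence of squares. -/
theorem sub_mul_adjugate_eq_zero (hL : 0 < L) (hq : IsRegularPotential q L K)
    (hH : ∃ AB : ℂ × ℂ, IsHadamardPair q L AB) (hr : IsRootBranch G r₀ r₄) {Φ₁ Φ₂ : ℂ → Mat2}
    (h₁ : IsRHPSolution G r₀ r₄ x Φ₁) (h₂ : IsRHPSolution G r₀ r₄ x Φ₂) {z : ℂ} (hz : z.im ≠ 0) :
    (Φ₁ z - Φ₂ z) * (Φ₂ z).adjugate = 0 := by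
  obtain ⟨P₁, M₁, cP₁, cM₁, tP₁, tM₁, j₁⟩ := h₁.boundary
  obtain ⟨P₂, M₂, cP₂, cM₂, tP₂, tM₂, j₂⟩ := h₂.boundary
  obtain ⟨C, hC⟩ := eventually_norm_sub_mul_adjugate_le hL hq hH hr h₁ h₂
  have hadj : Continuous fun A : Mat2 => A.adjugate := Continuous.matrix_adjugate continuous_id
  ext i j
  have hentry : Continuous fun A : Mat2 => A i j := continuous_id.matrix_elem i j
  suffices hext : ∃ F : ℂ → ℂ, Differentiable ℂ F ∧
      ∀ z, z.im ≠ 0 → F z = ((Φ₁ z - Φ₂ z) * (Φ₂ z).adjugate) i j by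
    obtain ⟨F, hF, hFeq⟩ := hext
    rw [Matrix.zero_apply, ← hFeq z hz]
    refine eq_zero_of_squares hF (tendsto_squareSize hL) (C := C) ?_ z
    filter_upwards [hC] with n hn w hw0 hw
    rw [hFeq w hw0]
    exact hn w ⟨hw0, hw⟩ i j
  refine exists_differentiable_extension (S := G.edges)
    (φ := fun t => ((P₁ t - P₂ t) * (P₂ t).adjugate) i j)
    (G.eventually_notMem_edges hL.le hq) ?_ ?_ ?_ ?_ ?_
  · have hd : ∀ i j, DifferentiableOn ℂ (fun z => (Φ₂ z).adjugate i j) {z | z.im ≠ 0} := by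
      intro i j
      simp only [Matrix.adjugate_fin_two]
      fin_cases i <;> fin_cases j
      · exact h₂.holo 1 1
      · exact (h₂.holo 0 1).neg
      · exact (h₂.holo 1 0).neg
      · exact h₂.holo 0 0
    simp only [Matrix.mul_apply, Fin.sum_univ_two, Matrix.sub_apply]
    exact (((h₁.holo i 0).sub (h₂.holo i 0)).mul (hd 0 j)).add
      (((h₁.holo i 1).sub (h₂.holo i 1)).mul (hd 1 j))
  · exact hentry.comp_continuousOn ((cP₁.sub cP₂).mul (hadj.comp_continuousOn cP₂))
  · intro t ht
    exact (hentry.tendsto _).comp (((tP₁ t ht).sub (tP₂ t ht)).mul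
      ((hadj.tendsto _).comp (tP₂ t ht)))
  · intro t ht
    have hlim := ((tM₁ t ht).sub (tM₂ t ht)).mul ((hadj.tendsto _).comp (tM₂ t ht))
    rw [← sub_mul_adjugate_boundary_eq hL hq hH cP₁ cM₁ cP₂ cM₂ j₁ j₂ ht] at hlim
    exact (hentry.tendsto _).comp hlim
  · intro e he
    obtain ⟨C₁, hC₁⟩ := h₁.edge e he
    obtain ⟨C₂, hC₂⟩ := h₂.edge e he
    refine ⟨2 * ((C₁ + C₂) * C₂), ?_⟩
    filter_upwards [hC₁, hC₂, self_mem_nhdsWithin] with w hw₁ hw₂ hw0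
    have hpos : 0 < ‖w - (e : ℂ)‖ := by
      rw [norm_pos_iff, sub_ne_zero]
      rintro rfl
      exact hw0 (Complex.ofReal_im e)
    have hp : ‖w - (e : ℂ)‖ ^ (-(1 / 4) : ℝ) * ‖w - (e : ℂ)‖ ^ (-(1 / 4) : ℝ) =
        ‖w - (e : ℂ)‖ ^ (-(1 / 2) : ℝ) := by
      rw [← Real.rpow_add hpos]
      norm_num
    have hsub : ∀ i j, ‖(Φ₁ w - Φ₂ w) i j‖ ≤ (C₁ + C₂) * ‖w - (e : ℂ)‖ ^ (-(1 / 4) : ℝ) := by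
      intro i j
      rw [Matrix.sub_apply, add_mul]
      exact (norm_sub_le _ _).trans (add_le_add (hw₁ i j) (hw₂ i j))
    refine (norm_mul_apply_le hsub (norm_adjugate_apply_le hw₂) i j).trans (le_of_eq ?_)
    rw [← hp]
    ring

/-- Far out on the imaginary axis the solutions of the Riemann-Hilbert problem agree. -/
theorem exists_eventually_eq_of_isHadamardPair (hL : 0 < L) (hq : IsRegularPotential q L K)
    (hH : ∃ AB : ℂ × ℂ, IsHadamardPair q L AB) (hr : IsRootBranch G r₀ r₄) {Φ₁ Φ₂ : ℂ → Mat2}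
    (h₁ : IsRHPSolution G r₀ r₄ x Φ₁) (h₂ : IsRHPSolution G r₀ r₄ x Φ₂) :
    ∃ a : ℝ, 0 < a ∧ ∀ b : ℝ, |b| = a → ∀ᶠ z in 𝓝 (⟨0, b⟩ : ℂ), Φ₁ z = Φ₂ z := by
  obtain ⟨C, R, hC⟩ := h₂.asymptotics (1 / (4 * L)) (by positivity)
  obtain ⟨n, hn, hgap, hbig⟩ := ((eventually_squareBoundary hL hq).and
    ((exists_le_norm_sub_of_mem_squareBoundary hL hq G).and
    ((tendsto_squareSize hL).eventually_ge_atTop (max (max R (4 * C)) 1)))).exists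
  have hpos : 0 < squareSize L n := lt_of_lt_of_le one_pos ((le_max_right _ _).trans hbig)
  refine ⟨squareSize L n, hpos, fun b hb => ?_⟩
  have hz := mk_mem_squareBoundary hpos hb
  set z₀ : ℂ := ⟨0, b⟩
  have hzn := le_norm_of_mem_squareBoundary hz
  have hz0 : 0 < ‖z₀‖ := hpos.trans_le hzn
  obtain ⟨N, hN, e⟩ := hC z₀ hz.1
    (((le_max_left _ _).trans (le_max_left _ _)).trans (hbig.trans hzn)) (hgap z₀ hz)
  have hC4 : 4 * C ≤ ‖z₀‖ := ((le_max_right _ _).trans (le_max_left _ _)).trans (hbig.trans hzn)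
  have hN' : ∀ i j, ‖N i j‖ ≤ 1 / 4 := fun i j => by
    refine (hN i j).trans ?_
    rw [div_le_div_iff₀ hz0 (by norm_num)]
    linarith
  obtain ⟨hM, hD, -⟩ := hn z₀ hz
  have hB : (matB q L r₀ r₄ z₀).det ≠ 0 := by
    intro h0
    have h := norm_det_matB_sq hH hr hz.1 hM hD
    rw [h0, norm_zero] at h
    have := norm_pos_iff.2 hM
    nlinarith
  have hdet : (Φ₂ z₀).det ≠ 0 := by
    rw [e, Matrix.det_mul, Matrix.det_mul, det_U]
    exact mul_ne_zero (mul_ne_zero (mul_ne_zero two_ne_zero Complex.I_ne_zero)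
      (det_one_add_ne_zero hN')) hB
  have hc : ∀ i j, ContinuousAt (fun z => Φ₂ z i j) z₀ := fun i j =>
    ((h₂.holo i j).differentiableAt (isOpen_im_ne_zero.mem_nhds hz.1)).continuousAt
  have hcd : ContinuousAt (fun z => (Φ₂ z).det) z₀ := by
    simp only [Matrix.det_fin_two]
    exact ((hc 0 0).mul (hc 1 1)).sub ((hc 0 1).mul (hc 1 0))
  filter_upwards [hcd.eventually_ne hdet, isOpen_im_ne_zero.mem_nhds hz.1] with z hz1 hz2
  exact eq_of_sub_mul_adjugate_eq_zero hz1 (sub_mul_adjugate_eq_zero hL hq hH hr h₁ h₂ hz2)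

/-- Without a Hadamard factorization the matrix `B` is zero by convention, and so are all solutions
at a large distance from the gaps. -/
theorem exists_forall_eq_zero_of_not_isHadamardPair (hH : ¬ ∃ AB : ℂ × ℂ, IsHadamardPair q L AB)
    (hr : IsRootBranch G r₀ r₄) {Φ : ℂ → Mat2} (h : IsRHPSolution G r₀ r₄ x Φ) :
    ∃ R : ℝ, ∀ z : ℂ, 1 ≤ |z.im| → R ≤ ‖z‖ → Φ z = 0 := by
  obtain ⟨C, R, hC⟩ := h.asymptotics 1 one_pos
  refine ⟨R, fun z hz hR => ?_⟩
  have hz0 : z.im ≠ 0 := fun h0 => by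
    rw [h0, abs_zero] at hz
    linarith
  obtain ⟨N, -, e⟩ := hC z hz0 hR fun k _ t _ => by
    refine hz.trans ?_
    simpa using Complex.abs_im_le_norm (z - (t : ℂ))
  have hr0 : r₀ z = 0 := by
    have := hr.sq₀ z hz0
    rw [fZero, hadamardExp, dif_neg hH, mul_zero, zero_mul] at this
    exact pow_eq_zero_iff two_ne_zero |>.1 this
  have hB : matB q L r₀ r₄ z = 0 := by simp [matB, hr0]
  rw [e, hB, Matrix.mul_zero]

/-- Solutions that agree near a point agree in its half plane. -/
theorem IsRHPSolution.eq_of_eventually_eq {Φ₁ Φ₂ : ℂ → Mat2} (h₁ : IsRHPSolution G r₀ r₄ x Φ₁)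
    (h₂ : IsRHPSolution G r₀ r₄ x Φ₂) {z₀ z : ℂ} (hz : 0 < z₀.im * z.im)
    (h : ∀ᶠ w in 𝓝 z₀, Φ₁ w = Φ₂ w) : Φ₁ z = Φ₂ z := by
  have hlin : IsLinearMap ℝ fun w : ℂ => w.im * z.im :=
    ⟨fun a b => by simp [add_mul], fun c a => by simp [mul_assoc]⟩
  have hconv : Convex ℝ {w : ℂ | 0 < w.im * z.im} := convex_halfSpace_gt hlin 0
  have hopen : IsOpen {w : ℂ | 0 < w.im * z.im} :=
    isOpen_lt continuous_const (Complex.continuous_im.mul continuous_const)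
  have hsub : {w : ℂ | 0 < w.im * z.im} ⊆ {w | w.im ≠ 0} := fun w hw h0 => by
    simp [h0] at hw
  have hz0 : z.im ≠ 0 := fun h0 => by simp [h0] at hz
  ext i j
  exact (((h₁.holo i j).mono hsub).analyticOnNhd hopen).eqOn_of_preconnected_of_eventuallyEq
    (((h₂.holo i j).mono hsub).analyticOnNhd hopen) hconv.isPreconnected hz
    (h.mono fun w hw => by simp only [hw]) (mul_self_pos.2 hz0)

end

end ZS

end

theorem mainTheorem1 (L : ℝ) (hL : 0 < L) (q : ℝ → ℂ) (hper : Function.Periodic q L)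
    (hq : ContDiffOn ℝ 2 q (Set.Icc 0 L)) (hq0 : ∃ s, q s ≠ 0)
    (G : ZS.GapLabelling q L) (r₀ r₄ : ℂ → ℂ) (hr : ZS.IsRootBranch G r₀ r₄) (x : ℝ)
    (Φ₁ Φ₂ : ℂ → ZS.Mat2)
    (h₁ : ZS.IsRHPSolution G r₀ r₄ x Φ₁) (h₂ : ZS.IsRHPSolution G r₀ r₄ x Φ₂) :
    ∀ z : ℂ, z.im ≠ 0 → Φ₁ z = Φ₂ z := by
  obtain ⟨K, hK⟩ := ZS.exists_isRegularPotential hL hper hq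
  have key : ∃ a : ℝ, 0 < a ∧ ∀ b : ℝ, |b| = a → ∀ᶠ z in 𝓝 (⟨0, b⟩ : ℂ), Φ₁ z = Φ₂ z := by
    by_cases hH : ∃ AB : ℂ × ℂ, ZS.IsHadamardPair q L AB
    · exact ZS.exists_eventually_eq_of_isHadamardPair hL hK hH hr h₁ h₂
    · obtain ⟨R₁, hR₁⟩ := ZS.exists_forall_eq_zero_of_not_isHadamardPair hH hr h₁
      obtain ⟨R₂, hR₂⟩ := ZS.exists_forall_eq_zero_of_not_isHadamardPair hH hr h₂
      refine ⟨max (max R₁ R₂) 1 + 1, by positivity, fun b hb => ?_⟩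
      have hev : ∀ᶠ z in 𝓝 (⟨0, b⟩ : ℂ), max (max R₁ R₂) 1 < |z.im| := by
        have hc : Continuous fun z : ℂ => |z.im| := Complex.continuous_im.abs
        refine hc.continuousAt.eventually (lt_mem_nhds ?_)
        change max (max R₁ R₂) 1 < |b|
        rw [hb]
        exact lt_add_one _
      filter_upwards [hev] with z hz
      have h1 : 1 ≤ |z.im| := (le_max_right _ _).trans hz.le
      have h2 : max R₁ R₂ ≤ ‖z‖ :=
        (le_max_left _ _).trans (hz.le.trans (Complex.abs_im_le_norm z))
      rw [hR₁ z h1 ((le_max_left _ _).trans h2), hR₂ z h1 ((le_max_right _ _).trans h2)]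
  obtain ⟨a, ha, hab⟩ := key
  intro z hz
  rcases lt_or_gt_of_ne hz with h | h
  · exact h₁.eq_of_eventually_eq h₂ (mul_pos_of_neg_of_neg (show -a < 0 by linarith) h)
      (hab (-a) (by rw [abs_neg, abs_of_pos ha]))
  · exact h₁.eq_of_eventually_eq h₂ (mul_pos (show 0 < a from ha) h) (hab a (abs_of_pos ha))
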